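/- Let $\Sigma$ be a finite alphabet and let $\mathcal F\subseteq\Sigma^*$ be a finite nonempty set of nonempty words that is reduced (no proper subword of a member is a member). Put $k=\max_{\phi\in\mathcal F}|\phi|$. For words $\tau,\omega$ let $$T(\tau,\omega)=\frac{1}{|\omega|-|\tau|+1}\,\#\{0\le i\le|\omega|-|\tau| : \omega_i\omega_{i+1}\cdots\omega_{i+|\tau|-1}=\tau\},$$ and $T(\tau,\omega)=0$ if $|\tau|>|\omega|$. Let $\xi:\mathbb N\to[0,\infty)$ satisfy $\xi(n)=o(1)$, $\xi(n)=\Omega(1/n)$ and $\xi(n)\ge 2|\Sigma|^{k-1}/n$ for all $n\ge1$. For $P\in[0,1]^{\mathcal F}$ let $$\overline{\mathcal B}_n(\mathcal F,P)=\{\omega\in\Sigma^n : T(\phi,\omega)\le P(\phi)+\xi(n)\text{ for all }\phi\in\mathcal F\},$$ and let $$\overline{\mathrm{cap}}(\mathcal F,P)=\limsup_{n\to\infty}\frac1n\log_2|\overline{\mathcal B}_n(\mathcal F,P)|\in[-\infty,\infty],\qquad \log_2 0=-\infty,$$ be the capacity of the weak semiconstrained system. A probability measure $\nu$ on $\Sigma^k$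 is shift invariant if $\sum_{a\in\Sigma}\nu(a,\sigma_1,\dots,\sigma_{k-1})=\sum_{a\in\Sigma}\nu(\sigma_1,\dots,\sigma_{k-1},a)$ for all $\sigma_1,\dots,\sigma_{k-1}\in\Sigma$. Let $M_\sigma(\Sigma^k)$ be the set of shift-invariant probability measures on $\Sigma^k$, let $$f:M_\sigma(\Sigma^k)\to[0,1]^{\mathcal F},\qquad f(\nu)(\phi)=\sum_{\omega\in\Sigma^k,\ \phi\text{ is a prefix of }\omega}\nu(\omega),$$ and let $\Delta_P=\{v\in[0,1]^{\mathcal F} : v(\phi)\le P(\phi)\text{ for all }\phi\in\mathcal F\}$. For $\nu\in M_\sigma(\Sigma^k)$ let $$I(\nu)=\sum_{\sigma\in\Sigma^k}\nu(\sigma)\log_2\frac{\nu(\sigma)}{\nu_1(\sigma_0,\dots,\sigma_{k-2})\,|\Sigma|^{-1}},\qquad \nu_1(\sigma_0,\dots,\sigma_{k-2})=\sum_{a\in\Sigma}\nu(\sigma_0,\dots,\sigma_{k-2},a),$$ where terms with $\nu(\sigma)=0$ are $0$; this is the large-deviations rate function of the empirical measure of $k$-tuples of i.i.d. uniformly distributed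 symbols of $\Sigma$. Then: 1. For every $P\in[0,1]^{\mathcal F}$ the limit superior that defines $\overline{\mathrm{cap}}(\mathcal F,P)$ is a limit in $[-\infty,\infty]$. 2. For every $P\in[0,1]^{\mathcal F}$ with $f^{-1}(\Delta_P)\ne\emptyset$, $$\overline{\mathrm{cap}}(\mathcal F,P)=\log_2|\Sigma|-\inf_{\mu\in f^{-1}(\Delta_P)}I(\mu)$$ (for a binary alphabet, $1-\inf_{\mu\in f^{-1}(\Delta_P)}I(\mu)$). 3. The function $P\mapsto\overline{\mathrm{cap}}(\mathcal F,P)$ is continuous on $\{P\in[0,1]^{\mathcal F} : f^{-1}(\Delta_P)\ne\emptyset\}$. -/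

import Mathlib

open Filter Topology

noncomputable section

namespace Semiconstrained

variable {α : Type*}

/-- A finite set of words is reduced if no proper subword of a member is a member. -/
def IsReduced (F : Finset (List α)) : Prop :=
  ∀ ω ∈ F, ∀ τ : List α, τ <:+: ω → τ.length < ω.length → τ ∉ F

/-- The frequency of `τ` as a subword of `ω`; it is `0` when `τ` is longer than `ω`. -/
def freq [DecidableEq α] (τ ω : List α) : ℝ :=
  if ω.length < τ.length then 0
  else (1 / ((ω.length : ℝ) - (τ.length : ℝ) + 1)) *
    ∑ i ∈ Finset.range (ω.length - τ.length + 1),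
      if (ω.drop i).take τ.length = τ then (1 : ℝ) else 0

/-- A tolerance function: nonnegative, `ξ(n) = o(1)` and `ξ(n) = Ω(1/n)`. -/
structure IsTolerance (ξ : ℕ → ℝ) : Prop where
  nonneg : ∀ n, 0 ≤ ξ n
  isLittleO : ξ =o[atTop] (fun _ => (1 : ℝ))
  isOmega : (fun n : ℕ => 1 / (n : ℝ)) =O[atTop] ξ

/-- The weak semiconstrained system of `(F, P)` with tolerance `ξ`. -/
def weakSystem [DecidableEq α] (F : Finset (List α)) (P : F → ℝ) (ξ : ℕ → ℝ) :
    Set (List α) :=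
  {ω | ∀ φ : F, freq (φ : List α) ω ≤ P φ + ξ ω.length}

/-- The words of length `n` of the weak semiconstrained system. -/
def weakWords [DecidableEq α] (F : Finset (List α)) (P : F → ℝ) (ξ : ℕ → ℝ) (n : ℕ) :
    Set (List α) :=
  weakSystem F P ξ ∩ {ω | ω.length = n}

theorem weakWords_finite [Fintype α] [DecidableEq α] (F : Finset (List α)) (P : F → ℝ)
    (ξ : ℕ → ℝ) (n : ℕ) : (weakWords F P ξ n).Finite :=
  (List.finite_length_eq α n).subset Set.inter_subset_right

/-- `(1/n) log₂` of the number of words of length `n`, in `[-∞, ∞]`, with `log₂ 0 = -∞`. -/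
def growthRate [DecidableEq α] (F : Finset (List α)) (P : F → ℝ) (ξ : ℕ → ℝ) (n : ℕ) :
    EReal :=
  if (weakWords F P ξ n).ncard = 0 then ⊥
  else (((1 / (n : ℝ)) * Real.logb 2 ((weakWords F P ξ n).ncard : ℝ) : ℝ) : EReal)

/-- The capacity of the weak semiconstrained system. -/
def weakCapacity [DecidableEq α] (F : Finset (List α)) (P : F → ℝ) (ξ : ℕ → ℝ) : EReal :=
  limsup (growthRate F P ξ) atTop

/-- The marginal on the first `k - 1` coordinates of a weight on `k`-tuples, `k = m + 1`. -/
def marginal [Fintype α] {m : ℕ} (ν : (Fin (m + 1) → α) → ℝ) (u : Fin m → α) : ℝ :=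
  ∑ a : α, ν (Fin.snoc (α := fun _ => α) u a)

def IsShiftInvariant [Fintype α] {m : ℕ} (ν : (Fin (m + 1) → α) → ℝ) : Prop :=
  ∀ u : Fin m → α,
    ∑ a : α, ν (Fin.cons (α := fun _ => α) a u) = ∑ a : α, ν (Fin.snoc (α := fun _ => α) u a)

/-- The shift-invariant probability measures on `k`-tuples, `k = m + 1`. -/
def shiftInvariantMeasures (α : Type*) [Fintype α] (m : ℕ) : Set ((Fin (m + 1) → α) → ℝ) :=
  {ν | ν ∈ stdSimplex ℝ (Fin (m + 1) → α) ∧ IsShiftInvariant ν}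

open Classical in
/-- The large-deviations rate function of the empirical measure of `k`-tuples, `k = m + 1`, of
i.i.d. symbols with law `q` (with `0 log 0 = 0`). -/
def rateFunction [Fintype α] {m : ℕ} (q : α → ℝ) (ν : (Fin (m + 1) → α) → ℝ) : EReal :=
  if IsShiftInvariant ν then
    ((∑ σ : Fin (m + 1) → α,
      ν σ * Real.logb 2 (ν σ / (marginal ν (Fin.init σ) * q (σ (Fin.last m)))) : ℝ) : EReal)
  else ⊤

/-- The `0`-`1` matrix whose `(φ, ω)` entry tells whether `φ` is a prefix of the tuple `ω`. -/
def prefixMatrix [DecidableEq α] (F : Finset (List α)) (m : ℕ) :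
    Matrix F (Fin (m + 1) → α) ℝ :=
  Matrix.of fun φ ω =>
    if (List.ofFn ω).take (φ : List α).length = (φ : List α) then 1 else 0

/-- The linear map `f` from measures on `k`-tuples, `k = m + 1`, to vectors indexed by `F`. -/
def wordMap [Fintype α] [DecidableEq α] (F : Finset (List α)) (m : ℕ)
    (ν : (Fin (m + 1) → α) → ℝ) : F → ℝ :=
  (prefixMatrix F m).mulVec ν

/-- The cube `[0,1]^F`. -/
def cube (F : Finset (List α)) : Set (F → ℝ) := {P | ∀ φ, P φ ∈ Set.Icc (0 : ℝ) 1}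

/-- The set `Δ` of vectors in `[0,1]^F` that are dominated by `P`. -/
def constraintSet (F : Finset (List α)) (P : F → ℝ) : Set (F → ℝ) :=
  {ν | ν ∈ cube F ∧ ∀ φ, ν φ ≤ P φ}

/-- The shift-invariant probability measures in `f⁻¹(Δ)`. -/
def feasible [Fintype α] [DecidableEq α] (F : Finset (List α)) (m : ℕ) (P : F → ℝ) :
    Set ((Fin (m + 1) → α) → ℝ) :=
  shiftInvariantMeasures α m ∩ wordMap F m ⁻¹' constraintSet F P

end Semiconstrained

end

/-!
The proof is the method of types on the de Bruijn graph, whose vertices are the words of length `m`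
and whose edges are the tuples of length `m + 1`. A word is a walk, its edge counts are an integral
flow, and a shift-invariant measure is a normalized flow. The rate function is `log₂ |α|` minus the
conditional entropy `tupleEntropy ν / log 2`, which is continuous in `ν`; so the claimed value of
the capacity is the maximum of the conditional entropy over the compact set of feasible measures.

Upper bound. Read cyclically, a word is a closed walk, whose normalized edge counts satisfy the
constraints up to `ξ n + m / n`. There are polynomially many possible edge counts, and each of them
belongs, for a given first vertex, to at most `exp (n * entropy)` words
(`card_edgeCount_eq_le`), because all of these words
are equally likely under the Markov chain with those transition frequencies. By compactness
(`exists_pos_of_feasible_subset`) the entropies that occur do not exceed the maximum in the limit;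
if no measure is feasible, there are no words of large length at all.

Lower bound. The tolerance is of order `1 / n`, so edge counts near `n ν` have to be realized up to
a bounded error. The flow `n ν` is rounded to an integral flow, each edge up or down
(`exists_balanced_rounding`), and every edge is used once more. Each of the two steps costs at most
one unit per edge, hence at most `|α| ^ m` occurrences of a word of `F`, which adds up to the
tolerance `2 * |α| ^ m / n`. The additional departures make the graph connected: if the
last departure from every vertex reads a fixed symbol `z`, then these last departures form a tree
directed towards the constant word `z ⋯ z`, and so the other departures can be arranged arbitrarily
and still give a closed walk that uses all edges (`exists_exits_eq`). The number of arrangements is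
a product of multinomial coefficients, which is `exp (n * entropy)` up to a polynomial factor.

Continuity. The maximum of a continuous function over the feasible set depends continuously on the
constraint vector, since the feasible set does so: it is upper hemicontinuous by compactness, and
lower hemicontinuous on the set of vectors where it is nonempty because the constraints are finitely
many linear inequalities (`exists_feasible_near`).
-/

noncomputable section

namespace Semiconstrained

/-! ### Words and arrangements -/

/-- The finite set of all words of length `n`. -/
def words (α : Type*) [Fintype α] : ℕ → Finset (List α)
  | 0 => {[]}
  | n + 1 => (Finset.univ ×ˢ words α n).map
      ⟨fun x : α × List α => x.1 :: x.2, fun x y h => by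
        have h' := List.cons.inj h
        exact Prod.ext h'.1 h'.2⟩

section Words

variable {α : Type*} [Fintype α]

theorem mem_words {n : ℕ} {w : List α} : w ∈ words α n ↔ w.length = n := by
  induction n generalizing w with
  | zero => simp [words]
  | succ n ih =>
    cases w with
    | nil => simp [words]
    | cons a w =>
      simp only [words, Finset.mem_map, Finset.mem_product, Finset.mem_univ, true_and, Prod.exists,
        List.length_cons, Nat.add_right_cancel_iff]
      refine ⟨fun ⟨b, w', h, h'⟩ => ?_, fun h => ⟨a, w, ih.2 h, rfl⟩⟩
      rw [← (List.cons.inj h').2]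
      exact ih.1 h

theorem sum_words_succ {M : Type*} [AddCommMonoid M] (n : ℕ) (f : List α → M) :
    ∑ w ∈ words α (n + 1), f w = ∑ a : α, ∑ w ∈ words α n, f (a :: w) := by
  simp only [words, Finset.sum_map, Finset.sum_product]
  rfl

theorem card_words (n : ℕ) : (words α n).card = Fintype.card α ^ n := by
  induction n with
  | zero => simp [words]
  | succ n ih => simp [words, ih, pow_succ, mul_comm]

variable [DecidableEq α]

/-- The finite set of words in which each symbol `a` occurs exactly `r a` times. -/
def arrangements (r : α → ℕ) : Finset (List α) :=
  {w ∈ words α (∑ a, r a) | ∀ a, w.count a = r a}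

theorem sum_count_eq_length (w : List α) : ∑ a, w.count a = w.length := by
  induction w with
  | nil => simp
  | cons b w ih => simp [List.count_cons, Finset.sum_add_distrib, ih]

theorem mem_arrangements {r : α → ℕ} {w : List α} :
    w ∈ arrangements r ↔ ∀ a, w.count a = r a := by
  simp only [arrangements, Finset.mem_filter, mem_words, and_iff_right_iff_imp]
  intro h
  rw [← sum_count_eq_length]
  exact Finset.sum_congr rfl fun a _ => h a

/-- The number of arrangements is at least the multinomial coefficient. -/
theorem factorial_le_card_arrangements_mul (r : α → ℕ) :
    (∑ a, r a).factorial ≤ (arrangements r).card * ∏ a, (r a).factorial := by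
  unfold arrangements
  generalize hn : ∑ a, r a = n
  induction n generalizing r with
  | zero =>
    have h0 : ∀ a, r a = 0 := by simpa using hn
    simp only [words, h0, Nat.factorial_zero, Finset.prod_const_one, mul_one,
      Nat.one_le_iff_ne_zero, ne_eq, Finset.card_eq_zero, ← Finset.nonempty_iff_ne_empty]
    exact ⟨[], by simp⟩
  | succ n ih =>
    have hcard : ({w ∈ words α (n + 1) | ∀ a, w.count a = r a}).card =
        ∑ b, ({w ∈ words α n | ∀ a, (b :: w).count a = r a}).card := by
      simp only [Finset.card_filter, sum_words_succ]
    rw [hcard, Finset.sum_mul, Nat.factorial_succ, ← hn, Finset.sum_mul]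
    refine Finset.sum_le_sum fun b _ => ?_
    rcases Nat.eq_zero_or_pos (r b) with hb | hb
    · simp [hb]
    · have hsum : ∑ a, Function.update r b (r b - 1) a = n := by
        have h1 := Finset.add_sum_erase Finset.univ r (Finset.mem_univ b)
        rw [Finset.sum_update_of_mem (Finset.mem_univ b), Finset.sdiff_singleton_eq_erase]
        omega
      have h := ih _ hsum
      have hfil : ({w ∈ words α n | ∀ a, w.count a = Function.update r b (r b - 1) a}) =
          {w ∈ words α n | ∀ a, (b :: w).count a = r a} := by
        ext w
        simp only [Finset.mem_filter, List.count_cons, Function.update_apply]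
        refine and_congr_right fun _ => forall_congr' fun a => ?_
        by_cases hab : a = b
        · subst hab
          simp only [beq_self_eq_true, if_true]
          omega
        · simp [hab, Ne.symm hab]
      have hprod : ∏ a, (r a).factorial =
          r b * ∏ a, (Function.update r b (r b - 1) a).factorial := by
        rw [← Finset.mul_prod_erase Finset.univ _ (Finset.mem_univ b),
          ← Finset.mul_prod_erase Finset.univ
            (fun a => (Function.update r b (r b - 1) a).factorial) (Finset.mem_univ b),
          ← mul_assoc, Function.update_self, Nat.mul_factorial_pred hb.ne']
        congr 1
        refine Finset.prod_congr rfl fun a ha => ?_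
        rw [Function.update_of_ne (Finset.ne_of_mem_erase ha)]
      rw [hfil] at h
      rw [hprod]
      calc r b * n.factorial ≤ r b * _ := Nat.mul_le_mul_left _ h
        _ = _ := by ring

end Words

/-! ### Walks and their exit lists -/

section Walks

variable {V α : Type*} [DecidableEq V] [DecidableEq α] (step : V → α → V)

/-- For the walk that starts at `s` and reads the word `w`, the list of the symbols that are read
on the successive departures from each vertex. -/
def exits : V → List α → V → List α
  | _, [] => fun _ => []
  | s, a :: w => Function.update (exits (step s a) w) s (a :: exits (step s a) w s)

/-- The number of times that the walk from `s` along `w` leaves the vertex `v` by `a`. -/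
def edgeCount (s : V) (w : List α) (v : V) (a : α) : ℕ := (exits step s w v).count a

variable {step}

theorem edgeCount_cons (s : V) (a : α) (w : List α) (v : V) (b : α) :
    edgeCount step s (a :: w) v b =
      edgeCount step (step s a) w v b + if v = s then (if b = a then 1 else 0) else 0 := by
  unfold edgeCount
  by_cases h : v = s
  · subst h
    simp [exits, List.count_cons, eq_comm (a := a)]
  · simp [exits, h]

variable [Fintype V] [Fintype α]

/-- The number of arrivals at `v` and the number of departures from `v` differ only by the
endpoints of the walk. -/
theorem edgeCount_balance (s : V) (w : List α) (v : V) :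
    (∑ u, ∑ a, if step u a = v then edgeCount step s w u a else 0) + (if s = v then 1 else 0) =
      (∑ a, edgeCount step s w v a) + if w.foldl step s = v then 1 else 0 := by
  induction w generalizing s with
  | nil => by_cases h : s = v <;> simp [edgeCount, exits, h]
  | cons a w ih =>
    have ih := ih (step s a)
    have h1 : ∀ u b, (if step u b = v then edgeCount step s (a :: w) u b else 0) =
        (if step u b = v then edgeCount step (step s a) w u b else 0) +
          (if u = s then (if b = a then (if step u b = v then 1 else 0) else 0) else 0) := by
      intro u b
      rw [edgeCount_cons]
      split_ifs <;> simp
    have h2 : ∑ u, ∑ b, (if u = s then (if b = a then (if step u b = v then 1 else 0) else 0)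
        else 0) = if step s a = v then 1 else 0 := by
      rw [Finset.sum_eq_single s (fun u _ hu => by simp [hu]) (by simp)]
      simp
    have h3 : ∑ b, (if v = s then (if b = a then 1 else 0) else 0) = if s = v then 1 else 0 := by
      by_cases h : v = s
      · simp [h]
      · simp [h, Ne.symm h]
    have h4 : (if (a :: w).foldl step s = v then 1 else 0) =
        if w.foldl step (step s a) = v then 1 else 0 := rfl
    simp only [h1, Finset.sum_add_distrib, h2, h4]
    simp only [edgeCount_cons, Finset.sum_add_distrib, h3]
    omega

theorem sum_edgeCount (s : V) (w : List α) : ∑ v, ∑ a, edgeCount step s w v a = w.length := by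
  induction w generalizing s with
  | nil => simp [edgeCount, exits]
  | cons a w ih =>
    simp only [edgeCount_cons, Finset.sum_add_distrib, ih, List.length_cons]
    congr 1
    rw [Finset.sum_eq_single s (fun u _ hu => by simp [hu]) (by simp)]
    simp

/-- The words of length `n` get total weight at most `1` from a substochastic transition kernel,
and the weight of a word depends only on the edge counts of its walk. -/
theorem sum_prod_pow_edgeCount_le_one (p : V → α → ℝ) (hp : ∀ v a, 0 ≤ p v a)
    (hp1 : ∀ v, ∑ a, p v a ≤ 1) (n : ℕ) (s : V) :
    ∑ w ∈ words α n, ∏ v, ∏ a, p v a ^ edgeCount step s w v a ≤ 1 := by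
  induction n generalizing s with
  | zero => simp [words, edgeCount, exits]
  | succ n ih =>
    have h : ∀ a w, ∏ v, ∏ b, p v b ^ edgeCount step s (a :: w) v b =
        p s a * ∏ v, ∏ b, p v b ^ edgeCount step (step s a) w v b := by
      intro a w
      simp only [edgeCount_cons, pow_add, Finset.prod_mul_distrib]
      rw [mul_comm]
      congr 1
      rw [Finset.prod_eq_single s (fun u _ hu => by simp [hu]) (by simp)]
      rw [Finset.prod_eq_single a (fun u _ hu => by simp [hu]) (by simp)]
      simp
    rw [sum_words_succ]
    simp only [h, ← Finset.mul_sum]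
    calc ∑ a, p s a * ∑ w ∈ words α n, ∏ v, ∏ b, p v b ^ edgeCount step (step s a) w v b
        ≤ ∑ a, p s a * 1 :=
          Finset.sum_le_sum fun a _ => mul_le_mul_of_nonneg_left (ih _) (hp _ _)
      _ ≤ 1 := by simpa using hp1 s

end Walks

section ExitLists

variable {V α : Type*} [DecidableEq V] [Fintype V] {step : V → α → V}

/-- Following prescribed exit lists until the walk is stuck uses an initial part of each list and
stops at a vertex whose list is used up. -/
theorem exists_walk_of_exit_lists (L : V → List α) (s : V) :
    ∃ (w : List α) (L' : V → List α),
      (∀ v, L v = exits step s w v ++ L' v) ∧ L' (w.foldl step s) = [] := by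
  generalize hn : ∑ v, (L v).length = n
  induction n generalizing L s with
  | zero =>
    have h0 : ∀ v, L v = [] := by simpa using hn
    exact ⟨[], L, fun v => by simp [exits], by simp [h0]⟩
  | succ n ih =>
    rcases hs : L s with _ | ⟨a, t⟩
    · exact ⟨[], L, fun v => by simp [exits], by simp [hs]⟩
    · have hsum : ∑ v, (Function.update L s t v).length = n := by
        have h1 := Finset.add_sum_erase Finset.univ (fun v => (L v).length) (Finset.mem_univ s)
        have h2 := Finset.add_sum_erase Finset.univ
          (fun v => (Function.update L s t v).length) (Finset.mem_univ s)
        have h3 : ∑ v ∈ Finset.univ.erase s, (Function.update L s t v).length =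
            ∑ v ∈ Finset.univ.erase s, (L v).length :=
          Finset.sum_congr rfl fun v hv => by
            rw [Function.update_of_ne (Finset.ne_of_mem_erase hv)]
        simp only [Function.update_self, hs, List.length_cons] at h1 h2
        omega
      obtain ⟨w, L', h1, h2⟩ := ih _ (step s a) hsum
      refine ⟨a :: w, L', fun v => ?_, h2⟩
      have h := h1 v
      by_cases hv : v = s
      · subst hv
        rw [Function.update_self] at h
        simp [exits, hs, h]
      · rw [Function.update_of_ne hv] at h
        simp [exits, hv, h]

variable [Fintype α] [DecidableEq α]

/-- Prescribed exit lists are those of a walk from the root, provided that they are balanced, that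
all of them end with the symbol `z`, and that reading `z` again and again leads from every vertex
to the root. A vertex with an unused exit has an unused exit to its `z`-successor, which by balance
has an unused exit as well; so the root would have one, where the walk is stuck. -/
theorem exists_exits_eq (L : V → List α) (root : V) (z : α)
    (hbal : ∀ v, (∑ u, ∑ a, if step u a = v then (L u).count a else 0) = ∑ a, (L v).count a)
    (hlast : ∀ v, ∃ t, L v = t ++ [z])
    (hroot : ∀ v, ∃ j : ℕ, (fun u => step u z)^[j] v = root) :
    ∃ w, exits step root w = L := by
  obtain ⟨w, L', h1, h2⟩ := exists_walk_of_exit_lists (step := step) L root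
  have hcount : ∀ v a, (L v).count a = edgeCount step root w v a + (L' v).count a := by
    intro v a
    rw [h1 v, List.count_append, edgeCount]
  have hleft : ∀ v, (∑ u, ∑ a, if step u a = v then (L' u).count a else 0) +
      (if w.foldl step root = v then 1 else 0) =
      (∑ a, (L' v).count a) + if root = v then 1 else 0 := by
    intro v
    have hb := hbal v
    have hw := edgeCount_balance (step := step) root w v
    have hsplit : (∑ u, ∑ a, if step u a = v then (L u).count a else 0) =
        (∑ u, ∑ a, if step u a = v then edgeCount step root w u a else 0) +
        ∑ u, ∑ a, if step u a = v then (L' u).count a else 0 := by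
      simp only [← Finset.sum_add_distrib, hcount]
      refine Finset.sum_congr rfl fun u _ => Finset.sum_congr rfl fun a _ => ?_
      split_ifs <;> simp
    rw [hsplit] at hb
    simp only [hcount, Finset.sum_add_distrib] at hb
    omega
  have hend : w.foldl step root = root := by
    by_contra hne
    have h := hleft (w.foldl step root)
    rw [h2, if_pos rfl, if_neg (Ne.symm hne)] at h
    simp at h
  have hbal' : ∀ v, (∑ u, ∑ a, if step u a = v then (L' u).count a else 0) =
      ∑ a, (L' v).count a := by
    intro v
    have h := hleft v
    rw [hend] at h
    omega
  rw [hend] at h2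
  have hprop : ∀ v, L' v ≠ [] → L' (step v z) ≠ [] := by
    intro v hv hnil
    have h := hbal' (step v z)
    rw [hnil] at h
    simp only [List.count_nil, Finset.sum_const_zero, Finset.sum_eq_zero_iff, Finset.mem_univ,
      true_implies] at h
    have h := h v z
    rw [if_pos rfl, List.count_eq_zero] at h
    obtain ⟨t, ht⟩ := hlast v
    rw [h1 v] at ht
    have hl := List.getLast_mem hv
    have : (L' v).getLast hv = z := by
      rw [← List.getLast_append_of_ne_nil (l := exits step root w v) (by simp [hv]) hv]
      simp [ht]
    exact h (this ▸ hl)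
  have hall : ∀ v, L' v = [] := by
    intro v
    by_contra hv
    obtain ⟨j, hj⟩ := hroot v
    have : ∀ j, L' ((fun u => step u z)^[j] v) ≠ [] := by
      intro j
      induction j with
      | zero => exact hv
      | succ j ih =>
        rw [Function.iterate_succ_apply']
        exact hprop _ ih
    exact this j (by rw [hj]; exact h2)
  exact ⟨w, funext fun v => by rw [h1 v, hall v, List.append_nil]⟩

/-- The closed walks that use each edge `(v, a)` exactly `R v a + 1` times are at least as many as
the arrangements of the departures counted by the balanced flow `R`: the single additional
departures are appended with `z` last, and the walk is recovered from its exit lists. -/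
theorem prod_card_arrangements_le (R : V → α → ℕ) (root : V) (z : α)
    (hbal : ∀ v, (∑ u, ∑ a, if step u a = v then R u a else 0) = ∑ a, R v a)
    (hreg : ∀ v, (∑ u, ∑ a, if step u a = v then 1 else 0) = Fintype.card α)
    (hroot : ∀ v, ∃ j : ℕ, (fun u => step u z)^[j] v = root) :
    ∏ v, (arrangements (R v)).card ≤
      ({w ∈ words α (∑ v, ∑ a, (R v a + 1)) |
        ∀ v a, edgeCount step root w v a = R v a + 1}).card := by
  set tail : List α := (Finset.univ.erase z).toList ++ [z] with htail
  have htc : ∀ a, tail.count a = 1 := by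
    intro a
    by_cases ha : a = z
    · subst ha
      rw [htail, List.count_append, List.count_eq_zero.2 (by simp)]
      simp
    · rw [htail, List.count_append, List.count_eq_one_of_mem (Finset.nodup_toList _) (by simp [ha]),
        List.count_eq_zero.2 (by simp [ha])]
  have hex : ∀ M : V → List α, (∀ v, M v ∈ arrangements (R v)) →
      ∃ w, exits step root w = fun v => M v ++ tail := by
    intro M hM
    simp only [mem_arrangements] at hM
    refine exists_exits_eq _ root z (fun v => ?_) (fun v => ⟨M v ++ (Finset.univ.erase z).toList,
      by simp [htail]⟩) hroot
    simp only [List.count_append, hM, htc]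
    have : ∀ u a, (if step u a = v then R u a + 1 else 0) =
        (if step u a = v then R u a else 0) + if step u a = v then 1 else 0 := by
      intro u a
      split_ifs <;> simp
    simp only [this, Finset.sum_add_distrib, hbal, hreg]
    simp
  rw [← Fintype.card_piFinset]
  choose! f hf using hex
  refine Finset.card_le_card_of_injOn f (fun M hM => ?_) fun M hM M' hM' h => ?_
  · have hM : ∀ v, M v ∈ arrangements (R v) := by simpa using hM
    have hc : ∀ v a, edgeCount step root (f M) v a = R v a + 1 := by
      intro v a
      rw [edgeCount, hf M hM, List.count_append, htc, mem_arrangements.1 (hM v)]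
    rw [Finset.mem_coe, Finset.mem_filter, mem_words]
    refine ⟨?_, hc⟩
    rw [← sum_edgeCount (step := step) root]
    simp only [hc]
  · have hM : ∀ v, M v ∈ arrangements (R v) := by simpa using hM
    have hM' : ∀ v, M' v ∈ arrangements (R v) := by simpa using hM'
    have h1 := hf M hM
    rw [h, hf M' hM'] at h1
    funext v
    exact (List.append_cancel_right (congrFun h1 v)).symm

end ExitLists

/-! ### Integral rounding of flows -/

section Rounding

variable {V E : Type*} [Fintype E] [DecidableEq V]

/-- In a balanced real flow, a vertex that meets an edge with nonintegral flow meets at least two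
ends of such edges. -/
theorem two_le_sum_ends (src tgt : E → V) (x : E → ℝ) (S : Finset E)
    (hS : ∀ e, e ∈ S ↔ x e ∉ (Int.castRingHom ℝ).range)
    (hbal : ∀ v, (∑ e, if tgt e = v then x e else 0) = ∑ e, if src e = v then x e else 0)
    (v : V) (hv : ∃ e ∈ S, src e = v ∨ tgt e = v) :
    2 ≤ ∑ e ∈ S, ((if src e = v then 1 else 0) + if tgt e = v then 1 else 0) := by
  classical
  obtain ⟨e₁, he₁, hend⟩ := hv
  by_contra! hlt
  rw [← Finset.add_sum_erase S _ he₁] at hlt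
  have h1 : ¬ (src e₁ = v ∧ tgt e₁ = v) := by
    rintro ⟨h, h'⟩
    simp only [h, h', if_true] at hlt
    omega
  have h2 : ∀ e ∈ S.erase e₁, src e ≠ v ∧ tgt e ≠ v := by
    have h0 : ∑ e ∈ S.erase e₁, ((if src e = v then 1 else 0) + if tgt e = v then 1 else 0)
        = 0 := by
      rcases hend with h | h <;> simp only [h, if_true] at hlt <;> omega
    rw [Finset.sum_eq_zero_iff] at h0
    intro e he
    have h := h0 e he
    constructor <;> intro h' <;> simp [h'] at h
  have hsum : ∑ e, (((if tgt e = v then 1 else 0) - if src e = v then 1 else 0 : ℤ) : ℝ) * x e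
      = 0 := by
    have h : ∀ e, (((if tgt e = v then 1 else 0) - if src e = v then 1 else 0 : ℤ) : ℝ) * x e =
        (if tgt e = v then x e else 0) - if src e = v then x e else 0 := by
      intro e
      split_ifs <;> simp
    simp only [h, Finset.sum_sub_distrib, hbal, sub_self]
  rw [← Finset.add_sum_erase Finset.univ _ (Finset.mem_univ e₁)] at hsum
  have hrest : ∑ e ∈ Finset.univ.erase e₁,
      (((if tgt e = v then 1 else 0) - if src e = v then 1 else 0 : ℤ) : ℝ) * x e ∈
      (Int.castRingHom ℝ).range := by
    refine Subring.sum_mem _ fun e he => ?_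
    by_cases heS : e ∈ S
    · have h := h2 e (Finset.mem_erase.2 ⟨Finset.ne_of_mem_erase he, heS⟩)
      simp [h.1, h.2]
    · rw [hS, not_not] at heS
      exact Subring.mul_mem _ ⟨_, rfl⟩ heS
  refine (hS e₁).1 he₁ ?_
  rcases hend with h | h
  · have h' : tgt e₁ ≠ v := fun h' => h1 ⟨h, h'⟩
    simp only [h, h', if_true, if_false] at hsum
    have : x e₁ = ∑ e ∈ Finset.univ.erase e₁,
        (((if tgt e = v then 1 else 0) - if src e = v then 1 else 0 : ℤ) : ℝ) * x e := by
      push_cast at hsum ⊢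
      linarith
    exact this ▸ hrest
  · have h' : src e₁ ≠ v := fun h' => h1 ⟨h', h⟩
    simp only [h, h', if_true, if_false] at hsum
    have : x e₁ = -∑ e ∈ Finset.univ.erase e₁,
        (((if tgt e = v then 1 else 0) - if src e = v then 1 else 0 : ℤ) : ℝ) * x e := by
      push_cast at hsum ⊢
      linarith
    exact this ▸ Subring.neg_mem _ hrest

variable [Fintype V]

/-- A nonempty set of edges in which every vertex that it meets meets two edge ends supports a
nonzero balanced flow: the boundary map has rank less than the number of those vertices, which is
at most the number of those edges. -/
theorem exists_balanced_supported (src tgt : E → V) (S : Finset E) (hne : S.Nonempty)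
    (hdeg : ∀ v, (∃ e ∈ S, src e = v ∨ tgt e = v) →
      2 ≤ ∑ e ∈ S, ((if src e = v then 1 else 0) + if tgt e = v then 1 else 0)) :
    ∃ y : E → ℝ, y ≠ 0 ∧ (∀ e, e ∉ S → y e = 0) ∧
      ∀ v, (∑ e, if tgt e = v then y e else 0) = ∑ e, if src e = v then y e else 0 := by
  classical
  set T : Finset V := {v | ∃ e ∈ S, src e = v ∨ tgt e = v} with hT
  have hcard : T.card ≤ S.card := by
    have h1 : T.card * 2 ≤
        ∑ v ∈ T, ∑ e ∈ S, ((if src e = v then 1 else 0) + if tgt e = v then 1 else 0) := by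
      rw [← smul_eq_mul]
      exact Finset.card_nsmul_le_sum _ _ _ fun v hv => hdeg v (by simpa [hT] using hv)
    have h2 : ∑ v ∈ T, ∑ e ∈ S, ((if src e = v then 1 else 0) + if tgt e = v then 1 else 0) ≤
        S.card * 2 := by
      rw [Finset.sum_comm, ← smul_eq_mul]
      refine Finset.sum_le_card_nsmul _ _ _ fun e _ => ?_
      rw [Finset.sum_add_distrib, Finset.sum_ite_eq, Finset.sum_ite_eq]
      split_ifs <;> simp
    omega
  let B : (S → ℝ) →ₗ[ℝ] (T → ℝ) :=
    { toFun := fun y v => ∑ e : S,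
        ((if tgt e = v then 1 else 0) - if src e = v then 1 else 0) * y e
      map_add' := fun y y' => by
        funext v
        simp only [Pi.add_apply, mul_add, Finset.sum_add_distrib]
      map_smul' := fun c y => by
        funext v
        simp only [Pi.smul_apply, smul_eq_mul, RingHom.id_apply, Finset.mul_sum]
        exact Finset.sum_congr rfl fun e _ => by ring }
  have hB : ∀ y v, B y v = ∑ e : S,
      ((if tgt e = v then 1 else 0) - if src e = v then 1 else 0) * y e := fun _ _ => rfl
  have hninj : ¬ Function.Injective B := by
    intro hinj
    have hle := LinearMap.finrank_le_finrank_of_injective hinj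
    have heq : Module.finrank ℝ (S → ℝ) = Module.finrank ℝ (T → ℝ) := by
      simp only [Module.finrank_fintype_fun_eq_card, Fintype.card_coe] at hle ⊢
      omega
    obtain ⟨y, hy⟩ :=
      (LinearMap.injective_iff_surjective_of_finrank_eq_finrank heq).1 hinj (fun _ => 1)
    have h0 : ∑ v : T, B y v = 0 := by
      simp only [hB]
      rw [Finset.sum_comm]
      refine Finset.sum_eq_zero fun e _ => ?_
      rw [← Finset.sum_mul, Finset.sum_sub_distrib]
      have ht : tgt e ∈ T := by simp only [hT, Finset.mem_filter_univ]; exact ⟨e, e.2, Or.inr rfl⟩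
      have hs : src e ∈ T := by simp only [hT, Finset.mem_filter_univ]; exact ⟨e, e.2, Or.inl rfl⟩
      rw [Finset.sum_coe_sort T (fun v => if tgt e = v then (1 : ℝ) else 0),
        Finset.sum_coe_sort T (fun v => if src e = v then (1 : ℝ) else 0),
        Finset.sum_ite_eq, Finset.sum_ite_eq, if_pos ht, if_pos hs]
      simp
    simp only [hy, Finset.sum_const, Finset.card_univ, Fintype.card_coe, nsmul_eq_mul, mul_one,
      Nat.cast_eq_zero, Finset.card_eq_zero] at h0
    obtain ⟨e, he⟩ := hne
    have : src e ∈ T := by simp only [hT, Finset.mem_filter_univ]; exact ⟨e, he, Or.inl rfl⟩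
    simp [h0] at this
  rw [← LinearMap.ker_eq_bot, Submodule.eq_bot_iff] at hninj
  push Not at hninj
  obtain ⟨y, hy, hy0⟩ := hninj
  rw [LinearMap.mem_ker] at hy
  let y' : E → ℝ := fun e => if h : e ∈ S then y ⟨e, h⟩ else 0
  have hy' : ∀ e : S, y' e = y e := fun e => by simp [y']
  refine ⟨y', fun h => hy0 ?_, fun e he => by simp [y', he], fun v => ?_⟩
  · funext e
    rw [← hy', h]
    rfl
  · by_cases hv : v ∈ T
    · have h := congrFun hy ⟨v, hv⟩
      rw [hB] at h
      simp only [← hy'] at h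
      rw [Finset.sum_coe_sort S
        (fun e => ((if tgt e = v then 1 else 0) - if src e = v then 1 else 0) * y' e),
        Finset.sum_subset (Finset.subset_univ S) (fun e _ he => by simp [y', he])] at h
      rw [← sub_eq_zero, ← Finset.sum_sub_distrib]
      refine (Finset.sum_congr rfl fun e _ => ?_).trans h
      split_ifs <;> simp
    · have hn : ∀ e ∈ S, src e ≠ v ∧ tgt e ≠ v := by
        intro e he
        simp only [hT, Finset.mem_filter_univ] at hv
        push Not at hv
        exact hv e he
      rw [Finset.sum_eq_zero, Finset.sum_eq_zero]
      · intro e _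
        by_cases he : e ∈ S
        · simp [(hn e he).1]
        · simp [y', he]
      · intro e _
        by_cases he : e ∈ S
        · simp [(hn e he).2]
        · simp [y', he]

/-- A balanced real flow can be rounded to a balanced integral flow, each edge up or down. -/
theorem exists_balanced_rounding (src tgt : E → V) (x : E → ℝ)
    (hbal : ∀ v, (∑ e, if tgt e = v then x e else 0) = ∑ e, if src e = v then x e else 0) :
    ∃ r : E → ℤ,
      (∀ v, (∑ e, if tgt e = v then r e else 0) = ∑ e, if src e = v then r e else 0) ∧
      ∀ e, ⌊x e⌋ ≤ r e ∧ r e ≤ ⌈x e⌉ := by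
  classical
  generalize hn : (Finset.univ.filter fun e => x e ∉ (Int.castRingHom ℝ).range).card = n
  induction n using Nat.strong_induction_on generalizing x with
  | _ n ih =>
    set S : Finset E := {e | x e ∉ (Int.castRingHom ℝ).range} with hSdef
    have hS : ∀ e, e ∈ S ↔ x e ∉ (Int.castRingHom ℝ).range := fun e => by simp [hSdef]
    rcases S.eq_empty_or_nonempty with hemp | hne
    · have hint : ∀ e, ∃ z : ℤ, (z : ℝ) = x e := by
        intro e
        have h := (hS e).not.1 (by simp [hemp])
        rw [not_not] at h
        exact h
      choose r hr using hint
      refine ⟨r, fun v => ?_, fun e => by simp [← hr]⟩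
      have h := hbal v
      simp only [← hr] at h
      exact_mod_cast h
    · obtain ⟨y, hy0, hyS, hybal⟩ :=
        exists_balanced_supported src tgt S hne (two_le_sum_ends src tgt x S hS hbal)
      -- `c e` is the step length at which the edge `e` reaches the next integer.
      let c : E → ℝ := fun e => if 0 < y e then (⌈x e⌉ - x e) / y e else (⌊x e⌋ - x e) / y e
      have hsupp : (Finset.univ.filter fun e => y e ≠ 0).Nonempty := by
        obtain ⟨e, he⟩ := Function.ne_iff.1 hy0
        exact ⟨e, by simpa using he⟩
      obtain ⟨e₀, he₀, hmin⟩ := Finset.exists_min_image _ c hsupp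
      simp only [Finset.mem_filter_univ] at he₀ hmin
      set t := c e₀ with ht
      have hc0 : 0 ≤ t := by
        simp only [ht, c]
        split_ifs with h
        · exact div_nonneg (sub_nonneg.2 (Int.le_ceil _)) h.le
        · exact div_nonneg_of_nonpos (sub_nonpos.2 (Int.floor_le _)) (not_lt.1 h)
      have hrange : ∀ e, (⌊x e⌋ : ℝ) ≤ x e + t * y e ∧ x e + t * y e ≤ ⌈x e⌉ := by
        intro e
        have h1 := Int.floor_le (x e)
        have h2 := Int.le_ceil (x e)
        rcases lt_trichotomy (y e) 0 with h | h | h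
        · have hm := hmin e h.ne
          simp only [c, if_neg (not_lt.2 h.le)] at hm
          rw [le_div_iff_of_neg h] at hm
          constructor <;> nlinarith
        · simp [h, h1, h2]
        · have hm := hmin e h.ne'
          simp only [c, if_pos h] at hm
          rw [le_div_iff₀ h] at hm
          constructor <;> nlinarith
      have he₀int : x e₀ + t * y e₀ ∈ (Int.castRingHom ℝ).range := by
        simp only [ht, c]
        split_ifs
        · exact ⟨⌈x e₀⌉, by rw [div_mul_cancel₀ _ he₀]; simp⟩
        · exact ⟨⌊x e₀⌋, by rw [div_mul_cancel₀ _ he₀]; simp⟩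
      have hless : (Finset.univ.filter fun e =>
          x e + t * y e ∉ (Int.castRingHom ℝ).range).card < n := by
        rw [← hn]
        refine Finset.card_lt_card ((Finset.ssubset_iff_of_subset fun e he => ?_).2 ⟨e₀, ?_, ?_⟩)
        · by_contra h
          rw [Finset.mem_filter_univ, hyS e h, mul_zero, add_zero] at he
          exact h ((hS e).2 he)
        · by_contra h
          exact he₀ (hyS _ h)
        · rw [Finset.mem_filter_univ, not_not]
          exact he₀int
      obtain ⟨r, hr, hr'⟩ := ih _ hless (fun e => x e + t * y e) (fun v => by
        have h : ∀ f : E → V, (∑ e, if f e = v then x e + t * y e else 0) =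
            (∑ e, if f e = v then x e else 0) + t * ∑ e, if f e = v then y e else 0 := by
          intro f
          rw [Finset.mul_sum, ← Finset.sum_add_distrib]
          refine Finset.sum_congr rfl fun e _ => ?_
          split_ifs <;> simp
        rw [h, h, hbal, hybal]) rfl
      refine ⟨r, hr, fun e => ⟨?_, ?_⟩⟩
      · exact (Int.le_floor.2 (hrange e).1).trans (hr' e).1
      · exact (hr' e).2.trans (Int.ceil_le.2 (hrange e).2)

end Rounding

/-! ### Tuples as edges of the de Bruijn graph -/

section DeBruijn

variable {α : Type*} {m : ℕ}

/-- The transition of the de Bruijn graph: append a symbol and drop the first one. -/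
def shift (v : Fin m → α) (a : α) : Fin m → α := Fin.tail (Fin.snoc (α := fun _ => α) v a)

theorem ofFn_snoc (v : Fin m → α) (a : α) :
    List.ofFn (Fin.snoc (α := fun _ => α) v a : Fin (m + 1) → α) = List.ofFn v ++ [a] := by
  rw [List.ofFn_succ']
  simp

theorem ofFn_append_cons (v : Fin m → α) (a : α) (w : List α) :
    List.ofFn v ++ a :: w = List.ofFn (Fin.snoc (α := fun _ => α) v a : Fin (m + 1) → α) ++ w := by
  rw [ofFn_snoc, List.append_assoc, List.singleton_append]

theorem ofFn_append_cons' (v : Fin m → α) (a : α) (w : List α) :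
    List.ofFn v ++ a :: w =
      (Fin.snoc (α := fun _ => α) v a : Fin (m + 1) → α) 0 :: (List.ofFn (shift v a) ++ w) := by
  rw [ofFn_append_cons, List.ofFn_succ, List.cons_append]
  rfl

theorem ofFn_foldl_shift (s : Fin m → α) (w : List α) :
    List.ofFn (w.foldl shift s) = (List.ofFn s ++ w).drop w.length := by
  induction w generalizing s with
  | nil => simp
  | cons a w ih =>
    rw [List.foldl_cons, ih, ofFn_append_cons', List.length_cons, List.drop_succ_cons]

/-- Reading one symbol again and again leads to a constant vertex. -/
theorem iterate_shift_const (v : Fin m → α) (z : α) :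
    (fun u => shift u z)^[m] v = fun _ => z := by
  have h : ∀ j (v : Fin m → α), (fun u => shift u z)^[j] v =
      (List.replicate j z).foldl shift v := by
    intro j
    induction j with
    | zero => intro v; rfl
    | succ j ih =>
      intro v
      rw [Function.iterate_succ_apply, ih, List.replicate_succ, List.foldl_cons]
  apply List.ofFn_injective
  rw [h, ofFn_foldl_shift, List.length_replicate, List.drop_left' (by simp)]
  simp

variable [Fintype α]

theorem sum_snoc {M : Type*} [AddCommMonoid M] (g : (Fin (m + 1) → α) → M) :
    ∑ σ, g σ = ∑ v : Fin m → α, ∑ a : α, g (Fin.snoc (α := fun _ => α) v a) := by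
  rw [← (Fin.snocEquiv fun _ => α).sum_comp, Fintype.sum_prod_type, Finset.sum_comm]
  rfl

theorem sum_cons {M : Type*} [AddCommMonoid M] (g : (Fin (m + 1) → α) → M) :
    ∑ σ, g σ = ∑ v : Fin m → α, ∑ a : α, g (Fin.cons (α := fun _ => α) a v) := by
  rw [← (Fin.consEquiv fun _ => α).sum_comp, Fintype.sum_prod_type, Finset.sum_comm]
  rfl

variable [DecidableEq α]

theorem sum_shift_eq {M : Type*} [AddCommMonoid M] (g : (Fin (m + 1) → α) → M) (v : Fin m → α) :
    (∑ u, ∑ a, if shift u a = v then g (Fin.snoc (α := fun _ => α) u a) else 0) =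
      ∑ a, g (Fin.cons (α := fun _ => α) a v) := by
  have h := sum_snoc (fun σ : Fin (m + 1) → α => if Fin.tail σ = v then g σ else 0)
  rw [sum_cons] at h
  unfold shift
  rw [← h, Finset.sum_eq_single v (fun u _ hu => by simp [Fin.tail_cons, hu]) (by simp)]
  simp [Fin.tail_cons]

theorem isShiftInvariant_iff (ν : (Fin (m + 1) → α) → ℝ) :
    IsShiftInvariant ν ↔ ∀ v,
      (∑ u, ∑ a, if shift u a = v then ν (Fin.snoc (α := fun _ => α) u a) else 0) =
        ∑ a, ν (Fin.snoc (α := fun _ => α) v a) := by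
  simp only [IsShiftInvariant, sum_shift_eq]

theorem sum_shift_one (v : Fin m → α) :
    (∑ u, ∑ a, if shift u a = v then 1 else 0) = Fintype.card α := by
  rw [sum_shift_eq (fun _ => 1)]
  simp

theorem wordMap_apply (F : Finset (List α)) (ν : (Fin (m + 1) → α) → ℝ) (φ : F) :
    wordMap F m ν φ =
      ∑ σ, if (List.ofFn σ).take (φ : List α).length = (φ : List α) then ν σ else 0 := by
  simp [wordMap, Matrix.mulVec, dotProduct, prefixMatrix]

/-- The occurrences of a short word `φ` along a walk, counted by the edges of the walk. -/
theorem sum_occurrences_eq (φ : List α) (hφ : φ.length ≤ m + 1) (s : Fin m → α) (w : List α) :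
    (∑ i ∈ Finset.range w.length,
      if ((List.ofFn s ++ w).drop i).take φ.length = φ then (1 : ℝ) else 0) =
    ∑ v : Fin m → α, ∑ a : α,
      if (List.ofFn (Fin.snoc (α := fun _ => α) v a : Fin (m + 1) → α)).take φ.length = φ then
        (edgeCount shift s w v a : ℝ) else 0 := by
  induction w generalizing s with
  | nil => simp [edgeCount, exits]
  | cons b w ih =>
    rw [List.length_cons, Finset.sum_range_succ']
    have h1 : ∀ i, (List.ofFn s ++ b :: w).drop (i + 1) = (List.ofFn (shift s b) ++ w).drop i := by
      intro i
      rw [ofFn_append_cons', List.drop_succ_cons]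
    have h2 : ((List.ofFn s ++ b :: w).drop 0).take φ.length =
        (List.ofFn (Fin.snoc (α := fun _ => α) s b : Fin (m + 1) → α)).take φ.length := by
      rw [List.drop_zero, ofFn_append_cons, List.take_append_of_le_length (by simpa using hφ)]
    simp only [h1, h2, ih]
    have h3 : ∀ v a, (if (List.ofFn (Fin.snoc (α := fun _ => α) v a :
          Fin (m + 1) → α)).take φ.length = φ then
          (edgeCount shift s (b :: w) v a : ℝ) else 0) =
        (if (List.ofFn (Fin.snoc (α := fun _ => α) v a : Fin (m + 1) → α)).take φ.length = φ then
          (edgeCount shift (shift s b) w v a : ℝ) else 0) +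
        if v = s then (if a = b then
          if (List.ofFn (Fin.snoc (α := fun _ => α) v a : Fin (m + 1) → α)).take φ.length = φ then
          (1 : ℝ) else 0 else 0) else 0 := by
      intro v a
      rw [edgeCount_cons]
      split_ifs <;> simp
    simp only [h3, Finset.sum_add_distrib]
    congr 1
    rw [Finset.sum_eq_single s (fun u _ hu => by simp [hu]) (by simp)]
    simp

end DeBruijn

/-! ### The entropy of a shift-invariant measure -/

section Entropy

variable {α : Type*} [Fintype α] {m : ℕ}

/-- The conditional entropy (in nats) of the last coordinate given the others, of a weight on
tuples. -/
def tupleEntropy (ν : (Fin (m + 1) → α) → ℝ) : ℝ :=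
  ∑ σ, Real.negMulLog (ν σ) - ∑ u, Real.negMulLog (marginal ν u)

theorem continuous_marginal (u : Fin m → α) :
    Continuous fun ν : (Fin (m + 1) → α) → ℝ => marginal ν u := by
  unfold marginal
  fun_prop

theorem continuous_tupleEntropy :
    Continuous (tupleEntropy : ((Fin (m + 1) → α) → ℝ) → ℝ) := by
  unfold tupleEntropy
  refine Continuous.sub ?_ ?_
  · fun_prop
  · exact continuous_finsetSum _ fun u _ => Real.continuous_negMulLog.comp (continuous_marginal u)

theorem le_marginal {ν : (Fin (m + 1) → α) → ℝ} (hν : ∀ σ, 0 ≤ ν σ) (u : Fin m → α) (a : α) :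
    ν (Fin.snoc (α := fun _ => α) u a) ≤ marginal ν u :=
  Finset.single_le_sum (f := fun a => ν (Fin.snoc (α := fun _ => α) u a))
    (fun _ _ => hν _) (Finset.mem_univ a)

/-- The entropy as a sum of the terms `ν log (ν₁ / ν)`. -/
theorem tupleEntropy_eq_sum (ν : (Fin (m + 1) → α) → ℝ) :
    tupleEntropy ν = ∑ u : Fin m → α, ∑ a : α, ν (Fin.snoc (α := fun _ => α) u a) *
      (Real.log (marginal ν u) - Real.log (ν (Fin.snoc (α := fun _ => α) u a))) := by
  rw [tupleEntropy, sum_snoc, ← Finset.sum_sub_distrib]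
  refine Finset.sum_congr rfl fun u _ => ?_
  have h : Real.negMulLog (marginal ν u) =
      ∑ a, -(ν (Fin.snoc (α := fun _ => α) u a) * Real.log (marginal ν u)) := by
    rw [Finset.sum_neg_distrib, ← Finset.sum_mul, Real.negMulLog, neg_mul]
    rfl
  rw [h, ← Finset.sum_sub_distrib]
  refine Finset.sum_congr rfl fun a _ => ?_
  rw [Real.negMulLog]
  ring

/-- The entropy is homogeneous of degree one. -/
theorem tupleEntropy_smul (c : ℝ) (hc : c ≠ 0) {ν : (Fin (m + 1) → α) → ℝ} (hν : ∀ σ, 0 ≤ ν σ) :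
    tupleEntropy (fun σ => c * ν σ) = c * tupleEntropy ν := by
  have hm : ∀ u, marginal (fun σ => c * ν σ) u = c * marginal ν u := fun u => by
    simp only [marginal, Finset.mul_sum]
  rw [tupleEntropy_eq_sum, tupleEntropy_eq_sum, Finset.mul_sum]
  refine Finset.sum_congr rfl fun u _ => ?_
  rw [Finset.mul_sum]
  refine Finset.sum_congr rfl fun a _ => ?_
  rcases (hν (Fin.snoc (α := fun _ => α) u a)).eq_or_lt with h | h
  · simp [← h]
  · have h' := h.trans_le (le_marginal hν u a)
    rw [hm, Real.log_mul hc h'.ne', Real.log_mul hc h.ne']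
    ring

theorem rateFunction_eq [Nonempty α] {ν : (Fin (m + 1) → α) → ℝ}
    (hν : ν ∈ shiftInvariantMeasures α m) :
    rateFunction (fun _ : α => 1 / (Fintype.card α : ℝ)) ν =
      ((Real.logb 2 (Fintype.card α) - tupleEntropy ν / Real.log 2 : ℝ) : EReal) := by
  obtain ⟨⟨h0, h1⟩, hinv⟩ := hν
  rw [rateFunction, if_pos hinv, EReal.coe_eq_coe_iff, tupleEntropy_eq_sum, sum_snoc]
  have hlog : Real.logb 2 (Fintype.card α) =
      ∑ u : Fin m → α, ∑ a : α,
        ν (Fin.snoc (α := fun _ => α) u a) * Real.logb 2 (Fintype.card α) := by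
    simp only [← Finset.sum_mul]
    rw [← sum_snoc, h1, one_mul]
  rw [hlog, Finset.sum_div, ← Finset.sum_sub_distrib]
  refine Finset.sum_congr rfl fun u _ => ?_
  rw [Finset.sum_div, ← Finset.sum_sub_distrib]
  refine Finset.sum_congr rfl fun a _ => ?_
  simp only [Fin.init_snoc]
  rcases (h0 (Fin.snoc (α := fun _ => α) u a)).eq_or_lt with h | h
  · simp [← h]
  · have h' := h.trans_le (le_marginal h0 u a)
    have hc : (0 : ℝ) < Fintype.card α := by exact_mod_cast Fintype.card_pos
    rw [one_div, Real.logb, Real.logb, Real.log_div h.ne' (by positivity),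
      Real.log_mul h'.ne' (by positivity), Real.log_inv]
    ring

end Entropy

/-! ### The feasible sets -/

section Feasible

variable {α : Type*} [Fintype α] {m : ℕ}

theorem isCompact_shiftInvariantMeasures : IsCompact (shiftInvariantMeasures α m) := by
  have h : IsClosed {ν : (Fin (m + 1) → α) → ℝ | ∀ u : Fin m → α,
      ∑ a : α, ν (Fin.cons (α := fun _ => α) a u) =
        ∑ a : α, ν (Fin.snoc (α := fun _ => α) u a)} := by
    rw [Set.ofPred_forall]
    exact isClosed_iInter fun u => isClosed_eq (by fun_prop) (by fun_prop)
  exact (isCompact_stdSimplex ℝ _).inter_right h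

variable [DecidableEq α] {F : Finset (List α)}

theorem continuous_wordMap : Continuous (wordMap F m) := by
  unfold wordMap
  fun_prop

theorem wordMap_mem_cube {ν : (Fin (m + 1) → α) → ℝ} (hν : ν ∈ shiftInvariantMeasures α m) :
    wordMap F m ν ∈ cube F := by
  intro φ
  rw [wordMap_apply]
  refine ⟨Finset.sum_nonneg fun σ _ => ?_, ?_⟩
  · split_ifs
    exacts [hν.1.1 σ, le_rfl]
  · rw [← hν.1.2]
    refine Finset.sum_le_sum fun σ _ => ?_
    split_ifs
    exacts [le_rfl, hν.1.1 σ]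

theorem mem_feasible_iff {P : F → ℝ} {ν : (Fin (m + 1) → α) → ℝ} :
    ν ∈ feasible F m P ↔ ν ∈ shiftInvariantMeasures α m ∧ ∀ φ, wordMap F m ν φ ≤ P φ :=
  ⟨fun h => ⟨h.1, h.2.2⟩, fun h => ⟨h.1, wordMap_mem_cube h.1, h.2⟩⟩

theorem isCompact_feasible (P : F → ℝ) : IsCompact (feasible F m P) := by
  have h : feasible F m P = shiftInvariantMeasures α m ∩ wordMap F m ⁻¹' Set.Iic P := by
    ext ν
    rw [mem_feasible_iff]
    rfl
  rw [h]
  exact isCompact_shiftInvariantMeasures.inter_right (isClosed_Iic.preimage continuous_wordMap)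

/-- Upper hemicontinuity of the feasible set in the constraint vector. -/
theorem exists_pos_of_feasible_subset {P : F → ℝ} {U : Set ((Fin (m + 1) → α) → ℝ)}
    (hU : IsOpen U) (hsub : feasible F m P ⊆ U) :
    ∃ δ > 0, ∀ ν ∈ shiftInvariantMeasures α m, (∀ φ, wordMap F m ν φ ≤ P φ + δ) → ν ∈ U := by
  have hK : IsCompact (shiftInvariantMeasures α m \ U) :=
    isCompact_shiftInvariantMeasures.diff hU
  let g : ((Fin (m + 1) → α) → ℝ) → ℝ := fun ν => ∑ φ, max (wordMap F m ν φ - P φ) 0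
  have hg : Continuous g := by
    have := continuous_wordMap (F := F) (m := m)
    fun_prop
  rcases (shiftInvariantMeasures α m \ U).eq_empty_or_nonempty with hemp | hne
  · exact ⟨1, one_pos, fun ν hν _ => by_contra fun h => by
      have : ν ∈ shiftInvariantMeasures α m \ U := ⟨hν, h⟩
      rw [hemp] at this
      exact this⟩
  · obtain ⟨ν₀, hν₀, hmin⟩ := hK.exists_isMinOn hne hg.continuousOn
    have hpos : 0 < g ν₀ := by
      have h : ¬ ∀ φ, wordMap F m ν₀ φ ≤ P φ := fun h =>
        hν₀.2 (hsub (mem_feasible_iff.2 ⟨hν₀.1, h⟩))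
      push Not at h
      obtain ⟨φ, hφ⟩ := h
      exact Finset.sum_pos' (fun _ _ => le_max_right _ _)
        ⟨φ, Finset.mem_univ _, lt_max_of_lt_left (sub_pos.2 hφ)⟩
    refine ⟨g ν₀ / (Fintype.card F + 1), by positivity, fun ν hν h => by_contra fun hνU => ?_⟩
    have h1 : g ν₀ ≤ g ν := hmin (show ν ∈ shiftInvariantMeasures α m \ U from ⟨hν, hνU⟩)
    have h2 : g ν ≤ Fintype.card F * (g ν₀ / (Fintype.card F + 1)) := by
      have h := Finset.sum_le_card_nsmul Finset.univ (fun φ => max (wordMap F m ν φ - P φ) 0)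
        (g ν₀ / (Fintype.card F + 1)) fun φ _ => max_le (by linarith [h φ]) (by positivity)
      rwa [nsmul_eq_mul, Finset.card_univ] at h
    have h3 : Fintype.card F * (g ν₀ / (Fintype.card F + 1)) < g ν₀ := by
      rw [← mul_div_assoc, div_lt_iff₀ (by positivity)]
      nlinarith
    linarith

/-- Lower hemicontinuity of the feasible set in the constraint vector. If it fails, then let `μ j`
be nearest to `ν` among the feasible measures for constraint vectors `P j → P`, with limit `μ'`.
Moving `μ j` by a small multiple of `ν - μ'` does not violate any constraint, since the constraints
that are tight at `μ'` do not increase along `ν - μ'`; but it brings `μ j` nearer to `ν`. -/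
theorem exists_feasible_near {P : F → ℝ} {ν : (Fin (m + 1) → α) → ℝ} (hν : ν ∈ feasible F m P)
    {ε : ℝ} (hε : 0 < ε) :
    ∀ᶠ Q in 𝓝 P, (feasible F m Q).Nonempty → ∃ μ ∈ feasible F m Q, ‖μ - ν‖ < ε := by
  by_contra hcon
  rw [Filter.not_eventually] at hcon
  obtain ⟨Q, hQ, hbad⟩ := Filter.exists_seq_forall_of_frequently hcon
  push Not at hbad
  have hex : ∀ j, ∃ μ ∈ feasible F m (Q j), IsMinOn (fun μ => ‖μ - ν‖) (feasible F m (Q j)) μ :=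
    fun j => (isCompact_feasible (Q j)).exists_isMinOn (hbad j).1 (by fun_prop)
  choose μ hμ hmin using hex
  obtain ⟨μ', hμ', ψ, hψ, hlim⟩ :=
    isCompact_shiftInvariantMeasures.tendsto_subseq fun j => (hμ j).1
  have hQψ : Tendsto (Q ∘ ψ) atTop (𝓝 P) := hQ.comp hψ.tendsto_atTop
  have hf : Tendsto (fun j => wordMap F m (μ (ψ j))) atTop (𝓝 (wordMap F m μ')) :=
    (continuous_wordMap.tendsto μ').comp hlim
  have hμ'P : ∀ φ, wordMap F m μ' φ ≤ P φ := fun φ =>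
    le_of_tendsto_of_tendsto' (tendsto_pi_nhds.1 hf φ) (tendsto_pi_nhds.1 hQψ φ)
      fun j => (hμ (ψ j)).2.2 φ
  have hlin : ∀ (ρ : (Fin (m + 1) → α) → ℝ) (t : ℝ) φ,
      wordMap F m (ρ + t • (ν - μ')) φ =
        wordMap F m ρ φ + t * (wordMap F m ν φ - wordMap F m μ' φ) := by
    intro ρ t φ
    simp [wordMap, Matrix.mulVec_add, Matrix.mulVec_smul, Matrix.mulVec_sub]
  -- A linear inequality that holds at `ν`, at the limit and along the sequence survives the move.
  have hkey : ∀ (b : ℕ → ℝ) (c : ℕ → ℝ) (b' c' d : ℝ), Tendsto b atTop (𝓝 b') →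
      Tendsto c atTop (𝓝 c') → (∀ j, b j ≤ c j) → b' + d ≤ c' →
      ∃ t₀ > 0, ∀ t, 0 < t → t ≤ t₀ → ∀ᶠ j in atTop, b j + t * d ≤ c j := by
    intro b c b' c' d hb hc hle hd
    rcases le_or_gt d 0 with h | h
    · refine ⟨1, one_pos, fun t ht _ => Eventually.of_forall fun j => ?_⟩
      nlinarith [hle j]
    · refine ⟨1 / 2, by norm_num, fun t ht ht' => ?_⟩
      have hlt : b' + t * d < c' := by nlinarith
      have := (hb.add_const (t * d)).eventually_lt hc hlt
      exact this.mono fun j hj => hj.le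
  have h1 : ∀ φ, ∃ t₀ > 0, ∀ t, 0 < t → t ≤ t₀ → ∀ᶠ j in atTop,
      wordMap F m (μ (ψ j)) φ + t * (wordMap F m ν φ - wordMap F m μ' φ) ≤ Q (ψ j) φ :=
    fun φ => hkey _ _ _ _ _ (tendsto_pi_nhds.1 hf φ) (tendsto_pi_nhds.1 hQψ φ)
      (fun j => (hμ (ψ j)).2.2 φ) (by linarith [hν.2.2 φ])
  have h2 : ∀ σ, ∃ t₀ > 0, ∀ t, 0 < t → t ≤ t₀ → ∀ᶠ j in atTop,
      -μ (ψ j) σ + t * (μ' σ - ν σ) ≤ 0 :=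
    fun σ => hkey _ (fun _ => 0) _ _ _ (tendsto_pi_nhds.1 hlim σ).neg tendsto_const_nhds
      (fun j => by simpa using (hμ (ψ j)).1.1.1 σ) (by linarith [hν.1.1.1 σ])
  choose t₁ ht₁ h1 using h1
  choose t₂ ht₂ h2 using h2
  obtain ⟨t, ht, ht1, ht2⟩ : ∃ t : ℝ, 0 < t ∧ (∀ φ, t ≤ t₁ φ) ∧ ∀ σ, t ≤ t₂ σ := by
    have e1 : ∀ φ, ∀ᶠ t in 𝓝[>] (0 : ℝ), t ≤ t₁ φ := fun φ =>
      (eventually_le_nhds (ht₁ φ)).filter_mono nhdsWithin_le_nhds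
    have e2 : ∀ σ, ∀ᶠ t in 𝓝[>] (0 : ℝ), t ≤ t₂ σ := fun σ =>
      (eventually_le_nhds (ht₂ σ)).filter_mono nhdsWithin_le_nhds
    obtain ⟨t, ⟨ha, hb⟩, hc⟩ := (((eventually_all.2 e1).and (eventually_all.2 e2)).and
      self_mem_nhdsWithin).exists
    exact ⟨t, hc, ha, hb⟩
  obtain ⟨s, hs, hst, hs1⟩ : ∃ s : ℝ, 0 < s ∧ s ≤ t ∧ s ≤ 1 :=
    ⟨min t 1, lt_min ht one_pos, min_le_left _ _, min_le_right _ _⟩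
  have hfeas : ∀ᶠ j in atTop, μ (ψ j) + s • (ν - μ') ∈ feasible F m (Q (ψ j)) := by
    filter_upwards [eventually_all.2 fun φ => h1 φ s hs (hst.trans (ht1 φ)),
      eventually_all.2 fun σ => h2 σ s hs (hst.trans (ht2 σ))] with j hj1 hj2
    refine mem_feasible_iff.2 ⟨⟨⟨fun σ => ?_, ?_⟩, fun u => ?_⟩, fun φ => ?_⟩
    · have := hj2 σ
      simp only [Pi.add_apply, Pi.smul_apply, Pi.sub_apply, smul_eq_mul]
      linarith
    · simp only [Pi.add_apply, Pi.smul_apply, Pi.sub_apply, smul_eq_mul, Finset.sum_add_distrib,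
        ← Finset.mul_sum, Finset.sum_sub_distrib, (hμ (ψ j)).1.1.2, hν.1.1.2, hμ'.1.2]
      ring
    · simp only [Pi.add_apply, Pi.smul_apply, Pi.sub_apply, smul_eq_mul, Finset.sum_add_distrib,
        ← Finset.mul_sum, Finset.sum_sub_distrib, (hμ (ψ j)).1.2 u, hν.1.2 u, hμ'.2 u]
    · rw [hlin]
      exact hj1 φ
  have hle : ∀ᶠ j in atTop, ‖μ (ψ j) - ν‖ ≤ ‖μ (ψ j) + s • (ν - μ') - ν‖ :=
    hfeas.mono fun j hj => hmin (ψ j) hj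
  have hl1 : Tendsto (fun j => ‖μ (ψ j) - ν‖) atTop (𝓝 ‖μ' - ν‖) :=
    (hlim.sub_const ν).norm
  have hl2 : Tendsto (fun j => ‖μ (ψ j) + s • (ν - μ') - ν‖) atTop
      (𝓝 ‖μ' + s • (ν - μ') - ν‖) :=
    ((hlim.add_const _).sub_const ν).norm
  have h3 := le_of_tendsto_of_tendsto hl1 hl2 hle
  have h4 : μ' + s • (ν - μ') - ν = (1 - s) • (μ' - ν) := by
    funext σ
    simp only [Pi.add_apply, Pi.smul_apply, Pi.sub_apply, smul_eq_mul]
    ring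
  rw [h4, norm_smul, Real.norm_of_nonneg (by linarith)] at h3
  have h5 : ε ≤ ‖μ' - ν‖ := ge_of_tendsto' hl1 fun j => (hbad (ψ j)).2 _ (hμ (ψ j))
  nlinarith

end Feasible

/-! ### Integral weights on tuples -/

section TupleWeight

variable {α : Type*} {m : ℕ}

/-- The weight on tuples with the value `N v a` at the edge `(v, a)` of the de Bruijn graph. -/
def tupleWeight (N : (Fin m → α) → α → ℕ) (σ : Fin (m + 1) → α) : ℝ :=
  N (Fin.init σ) (σ (Fin.last m))

theorem tupleWeight_nonneg (N : (Fin m → α) → α → ℕ) (σ : Fin (m + 1) → α) :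
    0 ≤ tupleWeight N σ := Nat.cast_nonneg _

theorem tupleWeight_snoc (N : (Fin m → α) → α → ℕ) (v : Fin m → α) (a : α) :
    tupleWeight N (Fin.snoc (α := fun _ => α) v a) = N v a := by
  simp [tupleWeight]

theorem marginal_tupleWeight [Fintype α] (N : (Fin m → α) → α → ℕ) (v : Fin m → α) :
    marginal (tupleWeight N) v = ∑ a, (N v a : ℝ) := by
  simp only [marginal, tupleWeight_snoc]

end TupleWeight

/-! ### Entropy estimates for the number of walks with given edge counts -/

section Estimates

theorem log_factorial_ge (n : ℕ) : n * Real.log n - n ≤ Real.log n.factorial := by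
  rcases Nat.eq_zero_or_pos n with rfl | hn
  · simp
  have hn' : (0 : ℝ) < n := by exact_mod_cast hn
  have hf : (0 : ℝ) < n.factorial := by exact_mod_cast n.factorial_pos
  have h := Real.log_le_log (by positivity) (Real.pow_div_factorial_le_exp (n : ℝ) hn'.le n)
  rw [Real.log_exp, Real.log_div (by positivity) hf.ne', Real.log_pow] at h
  linarith

theorem log_factorial_le (n : ℕ) :
    Real.log n.factorial ≤ (n + 1) * Real.log n - n + 1 := by
  induction n with
  | zero => simp
  | succ n ih =>
    rcases Nat.eq_zero_or_pos n with rfl | hn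
    · simp
    have hn' : (0 : ℝ) < n := by exact_mod_cast hn
    have hf : (0 : ℝ) < n.factorial := by exact_mod_cast n.factorial_pos
    have h := Real.one_sub_inv_le_log_of_pos (x := ((n : ℝ) + 1) / n) (by positivity)
    rw [Real.log_div (by positivity) hn'.ne', inv_div] at h
    have h' : 1 ≤ ((n : ℝ) + 1) * (Real.log (n + 1) - Real.log n) := by
      have h2 : ((n : ℝ) + 1) * (1 - n / (n + 1)) = 1 := by
        field_simp
        ring
      nlinarith
    rw [Nat.factorial_succ]
    push_cast
    rw [Real.log_mul (by positivity) hf.ne']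
    nlinarith

variable {α : Type*} [Fintype α] [DecidableEq α] {m : ℕ}

theorem entropy_le_log_card_arrangements (r : α → ℕ) {K : ℝ} (hK : 1 ≤ K)
    (hr : ∀ a, (r a : ℝ) ≤ K) :
    ∑ a, (r a : ℝ) * (Real.log (∑ b, (r b : ℝ)) - Real.log (r a)) -
      Fintype.card α * (Real.log K + 1) ≤ Real.log (arrangements r).card := by
  have h := factorial_le_card_arrangements_mul r
  have hcard : (0 : ℝ) < (arrangements r).card := by
    have : 0 < (arrangements r).card := by
      by_contra h0
      have h1 := (∑ a, r a).factorial_pos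
      have h2 : (arrangements r).card = 0 := by omega
      rw [h2, zero_mul] at h
      omega
    exact_mod_cast this
  have hf : ∀ a, (0 : ℝ) < (r a).factorial := fun a => by exact_mod_cast (r a).factorial_pos
  have h' : ((∑ a, r a).factorial : ℝ) ≤ (arrangements r).card * ∏ a, ((r a).factorial : ℝ) := by
    exact_mod_cast h
  have h1 := Real.log_le_log (by exact_mod_cast Nat.factorial_pos _) h'
  rw [Real.log_mul hcard.ne' (Finset.prod_pos fun a _ => hf a).ne',
    Real.log_prod fun a _ => (hf a).ne'] at h1
  have h2 := log_factorial_ge (∑ a, r a)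
  have h3 : ∑ a, Real.log ((r a).factorial : ℝ) ≤
      ∑ a, ((r a : ℝ) * Real.log (r a) - r a + (Real.log K + 1)) := by
    refine Finset.sum_le_sum fun a _ => (log_factorial_le (r a)).trans ?_
    have : Real.log (r a) ≤ Real.log K := by
      rcases Nat.eq_zero_or_pos (r a) with h0 | h0
      · simpa [h0] using Real.log_nonneg hK
      · exact Real.log_le_log (by exact_mod_cast h0) (hr a)
    linarith
  push_cast at h2
  simp only [mul_sub, Finset.sum_sub_distrib, Finset.sum_add_distrib, ← Finset.sum_mul,
    Finset.sum_const, Finset.card_univ, nsmul_eq_mul] at h3 ⊢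
  linarith

theorem entropy_le_log_prod_card_arrangements (N : (Fin m → α) → α → ℕ) {K : ℝ} (hK : 1 ≤ K)
    (hN : ∀ v a, (N v a : ℝ) ≤ K) :
    tupleEntropy (tupleWeight N) - Fintype.card α ^ (m + 1) * (Real.log K + 1) ≤
      Real.log ((∏ v, (arrangements (N v)).card : ℕ) : ℝ) := by
  have hne : ∀ v, ((arrangements (N v)).card : ℝ) ≠ 0 := by
    intro v h0
    have h := factorial_le_card_arrangements_mul (N v)
    have h1 := (∑ a, N v a).factorial_pos
    rw [Nat.cast_eq_zero.1 h0, zero_mul] at h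
    omega
  rw [Nat.cast_prod, Real.log_prod fun v _ => hne v, tupleEntropy_eq_sum]
  refine le_trans (le_of_eq ?_)
    (Finset.sum_le_sum fun v _ => entropy_le_log_card_arrangements (N v) hK (hN v))
  simp only [marginal_tupleWeight, tupleWeight_snoc, Finset.sum_sub_distrib
    (f := fun v : Fin m → α => ∑ a, (N v a : ℝ) * _), Finset.sum_const, Finset.card_univ, nsmul_eq_mul, Fintype.card_fun,
    Fintype.card_fin, Nat.cast_pow]
  ring

/-- The words that determine walks with given edge counts are at most exponential in the entropy of
the edge counts: each of them has the same weight for the transition probabilities that are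
proportional to the edge counts. -/
theorem card_edgeCount_eq_le (n : ℕ) (s : Fin m → α) (N : (Fin m → α) → α → ℕ) :
    (({w ∈ words α n | ∀ v a, edgeCount shift s w v a = N v a}).card : ℝ) ≤
      Real.exp (tupleEntropy (tupleWeight N)) := by
  -- At a vertex that is never left the transition probabilities are all `0 / 0 = 0`.
  set p : (Fin m → α) → α → ℝ := fun v a => N v a / ∑ b, (N v b : ℝ) with hp
  have hp0 : ∀ v a, 0 ≤ p v a := fun v a => by positivity
  have hp1 : ∀ v, ∑ a, p v a ≤ 1 := fun v => by
    simp only [hp, ← Finset.sum_div]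
    exact div_self_le_one _
  have hweight : ∏ v, ∏ a, p v a ^ N v a = Real.exp (-tupleEntropy (tupleWeight N)) := by
    rw [tupleEntropy_eq_sum, ← Finset.sum_neg_distrib, Real.exp_sum]
    refine Finset.prod_congr rfl fun v _ => ?_
    rw [← Finset.sum_neg_distrib, Real.exp_sum]
    refine Finset.prod_congr rfl fun a _ => ?_
    rw [marginal_tupleWeight, tupleWeight_snoc]
    rcases Nat.eq_zero_or_pos (N v a) with h0 | h0
    · simp [h0]
    · have h1 : (0 : ℝ) < N v a := by exact_mod_cast h0
      have h2 : (0 : ℝ) < ∑ b, (N v b : ℝ) :=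
        h1.trans_le (Finset.single_le_sum (f := fun b => (N v b : ℝ))
          (fun _ _ => Nat.cast_nonneg _) (Finset.mem_univ a))
      rw [← mul_neg, neg_sub, ← Real.log_div h1.ne' h2.ne', mul_comm, Real.exp_mul,
        Real.exp_log (div_pos h1 h2), Real.rpow_natCast]
  have h := sum_prod_pow_edgeCount_le_one (step := shift) p hp0 hp1 n s
  have h' : (({w ∈ words α n | ∀ v a, edgeCount shift s w v a = N v a}).card : ℝ) *
      Real.exp (-tupleEntropy (tupleWeight N)) ≤ 1 := by
    refine le_trans ?_ h
    rw [← hweight, ← nsmul_eq_mul, ← Finset.sum_const]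
    calc _ = ∑ w ∈ words α n with ∀ v a, edgeCount shift s w v a = N v a,
          ∏ v, ∏ a, p v a ^ edgeCount shift s w v a := by
          refine Finset.sum_congr rfl fun w hw => ?_
          simp only [(Finset.mem_filter.1 hw).2]
      _ ≤ _ := Finset.sum_le_sum_of_subset_of_nonneg (Finset.filter_subset _ _)
          fun w _ _ => Finset.prod_nonneg fun v _ => Finset.prod_nonneg fun a _ =>
            pow_nonneg (hp0 v a) _
  rwa [Real.exp_neg, ← div_eq_mul_inv, div_le_one (Real.exp_pos _)] at h'

end Estimates

/-! ### The upper bound -/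

section Upper

variable {α : Type*} [Fintype α] [DecidableEq α] {m : ℕ}

theorem isShiftInvariant_tupleWeight_iff (N : (Fin m → α) → α → ℕ) :
    IsShiftInvariant (tupleWeight N) ↔
      ∀ v, (∑ u, ∑ a, if shift u a = v then N u a else 0) = ∑ a, N v a := by
  rw [isShiftInvariant_iff]
  simp only [tupleWeight_snoc]
  exact forall_congr' fun v => by norm_cast

/-- A word read cyclically, from the vertex that consists of its last `m` symbols, is a closed walk.
Its edge counts are a shift-invariant weight in which every word of `F` has at most `m` more
occurrences than in the word itself. -/
theorem exists_closed_walk (n : ℕ) (hn : m + 1 ≤ n) (ω : List α) (hω : ω.length = n) :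
    ∃ s : Fin m → α,
      IsShiftInvariant (tupleWeight (edgeCount shift s ω)) ∧
      ∀ φ : List α, 1 ≤ φ.length → φ.length ≤ m + 1 →
        (∑ σ : Fin (m + 1) → α, if (List.ofFn σ).take φ.length = φ then
          tupleWeight (edgeCount shift s ω) σ else 0) ≤
          (n - φ.length + 1) * freq φ ω + m := by
  -- Starting from the last `m` symbols makes the walk end where it starts.
  obtain ⟨s, hs⟩ : ∃ s : Fin m → α, List.ofFn s = ω.drop (n - m) := by
    refine ⟨fun i => (ω.drop (n - m)).get (Fin.cast (by rw [List.length_drop]; omega) i), ?_⟩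
    apply List.ext_get
    · rw [List.length_ofFn, List.length_drop]
      omega
    · intro i h1 h2
      simp
  have hend : ω.foldl shift s = s := by
    apply List.ofFn_injective
    rw [ofFn_foldl_shift, hs, List.drop_append, List.drop_drop, List.length_drop, hω,
      List.drop_of_length_le (by omega), List.nil_append]
    congr 1
    omega
  refine ⟨s, ?_, fun φ hφ1 hφm => ?_⟩
  · rw [isShiftInvariant_tupleWeight_iff]
    intro v
    have h := edgeCount_balance (step := shift) s ω v
    rw [hend] at h
    exact Nat.add_right_cancel h
  · rw [sum_snoc]
    simp only [tupleWeight_snoc]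
    rw [← sum_occurrences_eq φ hφm s ω, hω]
    have hcast : ((n - φ.length + 1 : ℕ) : ℝ) = n - φ.length + 1 := by
      rw [Nat.cast_add, Nat.cast_sub (by omega), Nat.cast_one]
    have hfreq : (n - φ.length + 1) * freq φ ω = ∑ i ∈ Finset.range (n - φ.length + 1),
        if (ω.drop i).take φ.length = φ then (1 : ℝ) else 0 := by
      rw [freq, if_neg (by omega), hω, ← hcast, ← mul_assoc, mul_one_div_cancel, one_mul]
      rw [Nat.cast_add_one]
      positivity
    rw [hfreq]
    have hsplit : n = m + (n - m) := by omega
    conv_lhs => rw [hsplit, Finset.sum_range_add]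
    rw [add_comm]
    refine add_le_add ?_ ?_
    · have h1 : ∀ i, (List.ofFn s ++ ω).drop (m + i) = ω.drop i := by
        intro i
        rw [List.drop_append, List.drop_of_length_le (by simp), List.nil_append,
          List.length_ofFn, Nat.add_sub_cancel_left]
      simp only [h1]
      refine Finset.sum_le_sum_of_subset_of_nonneg (Finset.range_mono (by omega)) fun i _ _ => ?_
      split_ifs <;> simp
    · have h := Finset.sum_le_card_nsmul (Finset.range m) (fun i =>
        if ((List.ofFn s ++ ω).drop i).take φ.length = φ then (1 : ℝ) else 0) 1 (fun i _ => by
          split_ifs <;> simp)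
      simpa using h

/-- Up to a polynomial factor, the number of admissible words of length `n` is exponential in
`n` times the entropy of some shift-invariant measure that almost satisfies the constraints: the
normalized edge counts of the most frequent kind of cyclic walk. -/
theorem exists_measure_of_weakWords_nonempty {F : Finset (List α)} {P : F → ℝ} {ξ : ℕ → ℝ}
    (hP : ∀ φ, 0 ≤ P φ) (hξ : ∀ n, 0 ≤ ξ n)
    (hF : ∀ φ ∈ F, 1 ≤ φ.length ∧ φ.length ≤ m + 1) (n : ℕ) (hn : m + 1 ≤ n)
    (hne : (weakWords F P ξ n).Nonempty) :
    ∃ τ ∈ shiftInvariantMeasures α m, (∀ φ, wordMap F m τ φ ≤ P φ + (ξ n + m / n)) ∧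
      ((weakWords F P ξ n).ncard : ℝ) ≤
        Real.exp (n * tupleEntropy τ) *
          (Fintype.card α ^ m * (n + 1) ^ (Fintype.card α ^ (m + 1)) : ℕ) := by
  classical
  set B : Finset (List α) := (weakWords_finite F P ξ n).toFinset with hB
  have hmemB : ∀ ω, ω ∈ B ↔ (∀ φ : F, freq (φ : List α) ω ≤ P φ + ξ ω.length) ∧ ω.length = n :=
    fun ω => by rw [hB, Set.Finite.mem_toFinset]; rfl
  have hBne : B.Nonempty := by simpa [hB] using hne
  have hex : ∀ ω, ω ∈ B → _ := fun ω hω => exists_closed_walk (m := m) n hn ω ((hmemB ω).1 hω).2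
  have : Nonempty (Fin m → α) := ⟨(hex _ hBne.choose_spec).choose⟩
  choose! s hs1 hs2 using hex
  let T : Finset ((Fin m → α) × ((Fin m → α) → α → ℕ)) :=
    Finset.univ ×ˢ Fintype.piFinset fun _ => Fintype.piFinset fun _ => Finset.range (n + 1)
  have hTcard : T.card = Fintype.card α ^ m * (n + 1) ^ (Fintype.card α ^ (m + 1)) := by
    simp [T, ← pow_mul, pow_succ, mul_comm]
  let g : List α → (Fin m → α) × ((Fin m → α) → α → ℕ) := fun ω =>
    (s ω, edgeCount shift (s ω) ω)
  have hg : ∀ ω ∈ B, g ω ∈ T := by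
    intro ω hω
    simp only [T, g, Finset.mem_product, Finset.mem_univ, true_and, Fintype.mem_piFinset,
      Finset.mem_range]
    intro v a
    have h := sum_edgeCount (step := shift) (s ω) ω
    rw [((hmemB ω).1 hω).2] at h
    have h1 := Finset.single_le_sum (f := fun a => edgeCount shift (s ω) ω v a)
      (fun _ _ => Nat.zero_le _) (Finset.mem_univ a)
    have h2 := Finset.single_le_sum (f := fun v => ∑ a, edgeCount shift (s ω) ω v a)
      (fun _ _ => Nat.zero_le _) (Finset.mem_univ v)
    omega
  obtain ⟨ω₀, hω₀, hmax⟩ := Finset.exists_max_image B (fun ω => (B.filter (g · = g ω)).card) hBne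
  have hcard : B.card ≤ (B.filter (g · = g ω₀)).card * T.card := by
    refine Finset.card_le_mul_card_image_of_maps_to hg _ fun b _ => ?_
    rcases (B.filter (g · = b)).eq_empty_or_nonempty with h | ⟨ω, h⟩
    · simp [h]
    · rw [Finset.mem_filter] at h
      rw [← h.2]
      exact hmax ω h.1
  set N := edgeCount shift (s ω₀) ω₀ with hN
  have hn0 : (0 : ℝ) < n := by exact_mod_cast (by omega : 0 < n)
  have hlen := ((hmemB ω₀).1 hω₀).2
  have hfib : ((B.filter (g · = g ω₀)).card : ℝ) ≤ Real.exp (tupleEntropy (tupleWeight N)) := by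
    refine le_trans ?_ (card_edgeCount_eq_le n (s ω₀) N)
    exact_mod_cast Finset.card_le_card fun ω hω => by
      rw [Finset.mem_filter] at hω
      obtain ⟨h1, h2⟩ := Prod.ext_iff.1 hω.2
      simp only [g] at h1 h2
      rw [Finset.mem_filter, mem_words]
      refine ⟨((hmemB ω).1 hω.1).2, fun v a => ?_⟩
      rw [← h1, h2]
  have hsumN : ∑ σ, tupleWeight N σ = n := by
    rw [sum_snoc]
    simp only [tupleWeight_snoc]
    have h := sum_edgeCount (step := shift) (s ω₀) ω₀
    rw [hlen] at h
    exact_mod_cast h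
  refine ⟨fun σ => (n : ℝ)⁻¹ * tupleWeight N σ, ⟨⟨fun σ => ?_, ?_⟩, fun u => ?_⟩, fun φ => ?_, ?_⟩
  · exact mul_nonneg (by positivity) (tupleWeight_nonneg _ _)
  · rw [← Finset.mul_sum, hsumN, inv_mul_cancel₀ hn0.ne']
  · simp only [← Finset.mul_sum]
    congr 1
    exact hs1 ω₀ hω₀ u
  · have h := hs2 ω₀ hω₀ φ (hF φ φ.2).1 (hF φ φ.2).2
    have h' := ((hmemB ω₀).1 hω₀).1 φ
    rw [hlen] at h'
    have hl1 : (1 : ℝ) ≤ (φ : List α).length := by exact_mod_cast (hF φ φ.2).1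
    have hl2 : ((φ : List α).length : ℝ) ≤ n := by exact_mod_cast (hF φ φ.2).2.trans hn
    have h3 : (n - (φ : List α).length + 1) * freq (φ : List α) ω₀ ≤ n * (P φ + ξ n) := by
      have := hP φ
      have := hξ n
      calc (n - (φ : List α).length + 1) * freq (φ : List α) ω₀
          ≤ (n - (φ : List α).length + 1) * (P φ + ξ n) :=
            mul_le_mul_of_nonneg_left h' (by linarith)
        _ ≤ n * (P φ + ξ n) := mul_le_mul_of_nonneg_right (by linarith) (by linarith)
    have h4 : wordMap F m (fun σ => (n : ℝ)⁻¹ * tupleWeight N σ) φ =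
        (n : ℝ)⁻¹ * ∑ σ, if (List.ofFn σ).take (φ : List α).length = (φ : List α) then
          tupleWeight N σ else 0 := by
      rw [wordMap_apply, Finset.mul_sum]
      exact Finset.sum_congr rfl fun σ _ => by split_ifs <;> simp
    rw [h4, inv_mul_le_iff₀ hn0]
    have h5 : (n : ℝ) * (P φ + (ξ n + m / n)) = n * (P φ + ξ n) + m := by
      field_simp
      ring
    linarith
  · rw [tupleEntropy_smul _ (inv_ne_zero hn0.ne') (tupleWeight_nonneg N), ← mul_assoc,
      mul_inv_cancel₀ hn0.ne', one_mul, ← hTcard, Set.ncard_eq_toFinset_card _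
      (weakWords_finite F P ξ n)]
    calc (B.card : ℝ) ≤ ((B.filter (g · = g ω₀)).card * T.card : ℕ) := by exact_mod_cast hcard
      _ ≤ _ := by
        rw [Nat.cast_mul]
        exact mul_le_mul_of_nonneg_right hfib (Nat.cast_nonneg _)

end Upper

/-! ### The lower bound -/

section Lower

/-- A word of length `l = j + 1` that occurs at most `n p + 2 q ^ (m - j)` times among `n` symbols
has frequency at most `p + 2 q ^ m / n`, although only `n - j` positions are available. -/
theorem div_le_add_of_two_le (q m j n : ℕ) (hq : 2 ≤ q) (hj : j ≤ m) (hn : 2 * q ^ m ≤ n)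
    (hjn : j < n) (p C : ℝ) (hp1 : p ≤ 1) (hC : C ≤ n * p + 2 * (q : ℝ) ^ (m - j)) :
    1 / ((n : ℝ) - j) * C ≤ p + 2 * (q : ℝ) ^ m / n := by
  have hn0 : (0 : ℝ) < n := by exact_mod_cast (by omega : 0 < n)
  have hj0 : (0 : ℝ) ≤ j := Nat.cast_nonneg j
  have hjn' : (0 : ℝ) < (n : ℝ) - j := sub_pos.2 (by exact_mod_cast hjn)
  have hn' : 2 * (q : ℝ) ^ m / n ≤ 1 := by
    rw [div_le_one hn0]
    exact_mod_cast hn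
  have hpow : (q : ℝ) ^ m = (q : ℝ) ^ (m - j) * (q : ℝ) ^ j := by
    rw [← pow_add, Nat.sub_add_cancel hj]
  have hB : (1 : ℝ) ≤ (q : ℝ) ^ (m - j) := one_le_pow₀ (by exact_mod_cast (by omega : 1 ≤ q))
  have hQ : (j : ℝ) + 1 ≤ (q : ℝ) ^ j := by
    have h1 : j + 1 ≤ q ^ j := (Nat.lt_two_pow_self).trans_le (Nat.pow_le_pow_left hq j)
    exact_mod_cast h1
  have hmul : (n : ℝ) * (2 * (q : ℝ) ^ m / n) = 2 * (q : ℝ) ^ m := by field_simp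
  have hBQ : (q : ℝ) ^ (m - j) + j ≤ (q : ℝ) ^ m := by
    rw [hpow]
    nlinarith
  rw [one_div, inv_mul_le_iff₀ hjn']
  have h1 : ((n : ℝ) - j) * (p + 2 * (q : ℝ) ^ m / n) =
      n * p - j * p + 2 * (q : ℝ) ^ m - j * (2 * (q : ℝ) ^ m / n) := by
    linear_combination hmul
  rw [h1]
  nlinarith [mul_le_mul_of_nonneg_left hp1 hj0, mul_le_mul_of_nonneg_left hn' hj0]

theorem sum_ite_fst_eq {V α M : Type*} [Fintype α] [Fintype V] [DecidableEq V] [AddCommMonoid M]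
    (g : V × α → M) (v : V) : (∑ e : V × α, if e.1 = v then g e else 0) = ∑ a, g (v, a) := by
  rw [Fintype.sum_prod_type, Finset.sum_eq_single v (fun u _ hu => by simp [hu]) (by simp)]
  simp

theorem freq_le_one {α : Type*} [DecidableEq α] (φ ω : List α) : freq φ ω ≤ 1 := by
  unfold freq
  split_ifs with h
  · exact zero_le_one
  · have hcast : ((ω.length - φ.length + 1 : ℕ) : ℝ) = ω.length - φ.length + 1 := by
      rw [Nat.cast_add, Nat.cast_sub (by omega), Nat.cast_one]
    have h1 := Finset.sum_le_card_nsmul (Finset.range (ω.length - φ.length + 1))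
      (fun i => if (ω.drop i).take φ.length = φ then (1 : ℝ) else 0) 1 (fun i _ => by
        split_ifs <;> simp)
    rw [Finset.card_range, nsmul_eq_mul, mul_one] at h1
    rw [← hcast, one_div, inv_mul_le_iff₀ (by rw [Nat.cast_add_one]; positivity), mul_one]
    exact h1

variable {α : Type*} [Fintype α] [DecidableEq α] {m : ℕ}

/-- The number of tuples with a given prefix. -/
theorem card_prefix_le (φ : List α) :
    (Finset.univ.filter fun σ : Fin (m + 1) → α => (List.ofFn σ).take φ.length = φ).card ≤
      Fintype.card α ^ (m + 1 - φ.length) := by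
  rw [← card_words]
  refine Finset.card_le_card_of_injOn (fun σ => (List.ofFn σ).drop φ.length) (fun σ _ => ?_)
    fun σ hσ σ' hσ' h => ?_
  · simp [mem_words]
  · simp only [Finset.coe_filter, Finset.mem_univ, true_and] at hσ hσ'
    apply List.ofFn_injective
    dsimp only at h
    rw [← List.take_append_drop φ.length (List.ofFn σ), hσ, h]
    conv_rhs => rw [← List.take_append_drop φ.length (List.ofFn σ'), hσ']

/-- The initial part of length `n` of a walk that uses each edge `σ` at most `n ν σ + 2` times
satisfies the constraints of `ν`, within the tolerance. -/
theorem freq_take_le {P : ℝ} (hP1 : P ≤ 1) (φ : List α) (hφ1 : 1 ≤ φ.length)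
    (hφm : φ.length ≤ m + 1) {ν : (Fin (m + 1) → α) → ℝ} (hν : ∑ σ, ν σ = 1)
    (hνP : (∑ σ, if (List.ofFn σ).take φ.length = φ then ν σ else 0) ≤ P)
    (n : ℕ) (hn : m + 1 ≤ n) (hn' : 2 * Fintype.card α ^ m ≤ n) (s : Fin m → α) (w : List α)
    (hw : n ≤ w.length)
    (hcount : ∀ v a, (edgeCount shift s w v a : ℝ) ≤ n * ν (Fin.snoc (α := fun _ => α) v a) + 2) :
    freq φ ((List.ofFn s ++ w).take n) ≤ P + 2 * (Fintype.card α : ℝ) ^ m / n := by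
  have hn0 : (0 : ℝ) < n := by exact_mod_cast (by omega : 0 < n)
  rcases lt_or_ge (Fintype.card α) 2 with hq | hq
  · -- Over an alphabet with one symbol every tuple has the prefix `φ`, so that `P = 1`.
    have hsub : Subsingleton α := Fintype.card_le_one_iff_subsingleton.1 (by omega)
    have hpre : ∀ σ : Fin (m + 1) → α, (List.ofFn σ).take φ.length = φ := by
      intro σ
      apply List.ext_get
      · simp [hφm]
      · intro i h1 h2
        exact Subsingleton.elim _ _
    simp only [hpre, if_true, hν] at hνP
    have : 0 ≤ 2 * (Fintype.card α : ℝ) ^ m / n := by positivity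
    linarith [freq_le_one φ ((List.ofFn s ++ w).take n)]
  · have hlen : ((List.ofFn s ++ w).take n).length = n := by
      rw [List.length_take, List.length_append]
      omega
    obtain ⟨j, hj⟩ : ∃ j, φ.length = j + 1 := ⟨φ.length - 1, by omega⟩
    rw [freq, hlen, if_neg (by omega)]
    have hden : (n : ℝ) - (φ.length : ℝ) + 1 = n - j := by
      rw [hj]
      push_cast
      ring
    rw [hden]
    refine div_le_add_of_two_le _ m j n hq (by omega) hn' (by omega) P _ hP1 ?_
    have h1 : (∑ i ∈ Finset.range (n - φ.length + 1),
        if (((List.ofFn s ++ w).take n).drop i).take φ.length = φ then (1 : ℝ) else 0) ≤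
        ∑ i ∈ Finset.range w.length,
          if ((List.ofFn s ++ w).drop i).take φ.length = φ then (1 : ℝ) else 0 := by
      calc _ = ∑ i ∈ Finset.range (n - φ.length + 1),
            if ((List.ofFn s ++ w).drop i).take φ.length = φ then (1 : ℝ) else 0 := by
            refine Finset.sum_congr rfl fun i hi => ?_
            rw [Finset.mem_range] at hi
            rw [List.drop_take, List.take_take, min_eq_left (by omega)]
        _ ≤ _ := Finset.sum_le_sum_of_subset_of_nonneg (Finset.range_mono (by omega))
            fun i _ _ => by split_ifs <;> simp
    refine h1.trans ?_
    rw [sum_occurrences_eq φ hφm]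
    calc _ ≤ ∑ v : Fin m → α, ∑ a : α,
          if (List.ofFn (Fin.snoc (α := fun _ => α) v a : Fin (m + 1) → α)).take φ.length = φ then
            (n * ν (Fin.snoc (α := fun _ => α) v a) + 2 : ℝ) else 0 := by
          refine Finset.sum_le_sum fun v _ => Finset.sum_le_sum fun a _ => ?_
          split_ifs
          exacts [hcount v a, le_rfl]
      _ = ∑ σ : Fin (m + 1) → α,
          if (List.ofFn σ).take φ.length = φ then (n * ν σ + 2 : ℝ) else 0 := by
          rw [sum_snoc]
      _ = n * (∑ σ : Fin (m + 1) → α, if (List.ofFn σ).take φ.length = φ then ν σ else 0) +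
          2 * (Finset.univ.filter fun σ : Fin (m + 1) → α =>
            (List.ofFn σ).take φ.length = φ).card := by
          rw [Finset.card_filter, Nat.cast_sum, Finset.mul_sum, Finset.mul_sum,
            ← Finset.sum_add_distrib]
          refine Finset.sum_congr rfl fun σ _ => ?_
          split_ifs <;> simp
      _ ≤ n * P + 2 * (Fintype.card α : ℝ) ^ (m - j) := by
          have h2 := card_prefix_le (m := m) φ
          rw [hj, Nat.add_sub_add_right] at h2
          have h3 : ((Finset.univ.filter fun σ : Fin (m + 1) → α =>
            (List.ofFn σ).take φ.length = φ).card : ℝ) ≤ (Fintype.card α : ℝ) ^ (m - j) := by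
            rw [hj]
            exact_mod_cast h2
          have h4 := mul_le_mul_of_nonneg_left hνP hn0.le
          linarith

/-- A shift-invariant measure times `n` is rounded to an integral shift-invariant weight. -/
theorem exists_tupleWeight_near {ν : (Fin (m + 1) → α) → ℝ} (hν0 : ∀ σ, 0 ≤ ν σ)
    (hν : IsShiftInvariant ν) (n : ℕ) :
    ∃ N : (Fin m → α) → α → ℕ, IsShiftInvariant (tupleWeight N) ∧
      ∀ σ, |tupleWeight N σ - n * ν σ| ≤ 1 := by
  obtain ⟨r, hr, hr'⟩ := exists_balanced_rounding (V := Fin m → α) (E := (Fin m → α) × α) Prod.fst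
    (fun e => shift e.1 e.2) (fun e => n * ν (Fin.snoc (α := fun _ => α) e.1 e.2)) (by
      intro v
      have h := (isShiftInvariant_iff ν).1 hν v
      rw [sum_ite_fst_eq (fun e : (Fin m → α) × α =>
        (n : ℝ) * ν (Fin.snoc (α := fun _ => α) e.1 e.2)), Fintype.sum_prod_type]
      have h' := congrArg (fun t => (n : ℝ) * t) h
      simpa only [Finset.mul_sum, mul_ite, mul_zero] using h')
  have hr0 : ∀ e, 0 ≤ r e := fun e =>
    (Int.floor_nonneg.2 (mul_nonneg (Nat.cast_nonneg n) (hν0 _))).trans (hr' e).1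
  choose N hN using fun e => Int.eq_ofNat_of_zero_le (hr0 e)
  refine ⟨fun v a => N (v, a), ?_, fun σ => ?_⟩
  · rw [isShiftInvariant_tupleWeight_iff]
    intro v
    have h := hr v
    rw [sum_ite_fst_eq, Fintype.sum_prod_type] at h
    simp only [hN] at h
    exact_mod_cast h
  · have h := hr' (Fin.init σ, σ (Fin.last m))
    simp only [Fin.snoc_init_self] at h
    have hc : tupleWeight (fun v a => N (v, a)) σ = (r (Fin.init σ, σ (Fin.last m)) : ℝ) := by
      rw [tupleWeight, hN, Int.cast_natCast]
    rw [hc, abs_le]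
    have h1 := Int.lt_floor_add_one (n * ν σ)
    have h2 := Int.ceil_lt_add_one (n * ν σ)
    have h3 : (⌊n * ν σ⌋ : ℝ) ≤ r (Fin.init σ, σ (Fin.last m)) := by exact_mod_cast h.1
    have h4 : (r (Fin.init σ, σ (Fin.last m)) : ℝ) ≤ ⌈n * ν σ⌉ := by exact_mod_cast h.2
    constructor <;> linarith

/-- For a feasible measure `ν` there are, up to a polynomial factor, at least as many admissible
words of length `n` as the exponential of the entropy of an integral weight near `n ν`. They are cut
from the closed walks that use each edge once more than prescribed by that weight. -/
theorem exists_weight_le_ncard_weakWords [Nonempty α] {F : Finset (List α)} {P : F → ℝ} {ξ : ℕ → ℝ}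
    (hP : ∀ φ, P φ ≤ 1) (hF : ∀ φ ∈ F, 1 ≤ φ.length ∧ φ.length ≤ m + 1) (n : ℕ)
    (hξ : 2 * (Fintype.card α : ℝ) ^ m / n ≤ ξ n) (hn : m + 1 ≤ n)
    (hn' : 2 * Fintype.card α ^ m ≤ n) {ν : (Fin (m + 1) → α) → ℝ} (hν : ν ∈ feasible F m P) :
    ∃ N : (Fin m → α) → α → ℕ, (∀ σ, |tupleWeight N σ - n * ν σ| ≤ 1) ∧
      0 < (weakWords F P ξ n).ncard ∧
      tupleEntropy (tupleWeight N) -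
          Fintype.card α ^ (m + 1) * (Real.log ((n + 1 : ℕ) : ℝ) + 1) ≤
        Real.log (((weakWords F P ξ n).ncard *
          Fintype.card α ^ (2 * Fintype.card α ^ (m + 1) + m) : ℕ) : ℝ) := by
  classical
  obtain ⟨N, hNinv, hN⟩ := exists_tupleWeight_near hν.1.1.1 hν.1.2 n
  rw [isShiftInvariant_tupleWeight_iff] at hNinv
  have hbound : ∀ v a, (N v a : ℝ) ≤ n * ν (Fin.snoc (α := fun _ => α) v a) + 1 ∧
      n * ν (Fin.snoc (α := fun _ => α) v a) ≤ N v a + 1 := by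
    intro v a
    have h := abs_le.1 (hN (Fin.snoc (α := fun _ => α) v a))
    rw [tupleWeight_snoc] at h
    constructor <;> linarith [h.1, h.2]
  have hν1 : ∀ σ, ν σ ≤ 1 := fun σ => by
    rw [← hν.1.1.2]
    exact Finset.single_le_sum (f := ν) (fun σ _ => hν.1.1.1 σ) (Finset.mem_univ σ)
  refine ⟨N, hN, ?_⟩
  obtain ⟨z⟩ := ‹Nonempty α›
  set root : Fin m → α := fun _ => z with hroot
  set W := {w ∈ words α (∑ v, ∑ a, (N v a + 1)) |
    ∀ v a, edgeCount shift root w v a = N v a + 1} with hW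
  set ℓ := ∑ v, ∑ a, (N v a + 1) with hℓ
  have hcardE : (∑ _v : Fin m → α, ∑ _a : α, (1 : ℕ)) = Fintype.card α ^ (m + 1) := by
    simp [pow_succ]
  have hsumν : ∑ v, ∑ a, (n : ℝ) * ν (Fin.snoc (α := fun _ => α) v a) = n := by
    simp only [← Finset.mul_sum]
    rw [← sum_snoc, hν.1.1.2, mul_one]
  -- Rounding down loses at most what the additional use of each edge gains, so that the walks are
  -- long enough; their length exceeds `n` only by a constant.
  have hℓ1 : n ≤ ℓ := by
    have h : (n : ℝ) ≤ ℓ := by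
      rw [← hsumν, hℓ]
      push_cast
      exact Finset.sum_le_sum fun v _ => Finset.sum_le_sum fun a _ => (hbound v a).2
    exact_mod_cast h
  have hℓ2 : ℓ ≤ n + 2 * Fintype.card α ^ (m + 1) := by
    have h : (ℓ : ℝ) ≤ n + 2 * (Fintype.card α ^ (m + 1) : ℕ) := by
      rw [← hcardE, hℓ]
      conv_rhs => rw [← hsumν]
      push_cast
      rw [Finset.mul_sum, ← Finset.sum_add_distrib]
      refine Finset.sum_le_sum fun v _ => ?_
      rw [Finset.mul_sum, ← Finset.sum_add_distrib]
      refine Finset.sum_le_sum fun a _ => ?_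
      linarith [(hbound v a).1]
    exact_mod_cast h
  have hprod : ∏ v, (arrangements (N v)).card ≤ W.card :=
    prod_card_arrangements_le N root z hNinv sum_shift_one
      fun v => ⟨m, iterate_shift_const v z⟩
  -- A walk is determined by its first `n` symbols and a remainder of bounded length.
  have hWcard : W.card ≤ (weakWords F P ξ n).ncard * Fintype.card α ^ (ℓ + m - n) := by
    rw [Set.ncard_eq_toFinset_card _ (weakWords_finite F P ξ n), ← card_words,
      ← Finset.card_product]
    refine Finset.card_le_card_of_injOn
      (fun w => ((List.ofFn root ++ w).take n, (List.ofFn root ++ w).drop n)) (fun w hw => ?_)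
      fun w _ w' _ h => ?_
    · rw [Finset.mem_coe, hW, Finset.mem_filter, mem_words] at hw
      obtain ⟨hwl, hwc⟩ := hw
      rw [Finset.mem_coe, Finset.mem_product, Set.Finite.mem_toFinset, mem_words]
      have hlen : ((List.ofFn root ++ w).take n).length = n := by
        rw [List.length_take, List.length_append]
        omega
      refine ⟨⟨fun φ => ?_, hlen⟩, ?_⟩
      · rw [hlen]
        refine (freq_take_le (hP φ) φ (hF φ φ.2).1 (hF φ φ.2).2 hν.1.1.2 ?_ n hn hn' root w
          (by omega) fun v a => ?_).trans (add_le_add_right hξ _)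
        · rw [← wordMap_apply]
          exact hν.2.2 φ
        · rw [hwc]
          push_cast
          linarith [(hbound v a).1]
      · rw [List.length_drop, List.length_append, List.length_ofFn, hwl, add_comm m ℓ]
    · have h1 := (Prod.ext_iff.1 h).1
      have h2 := (Prod.ext_iff.1 h).2
      simp only at h1 h2
      apply List.append_cancel_left (as := List.ofFn root)
      rw [← List.take_append_drop n (List.ofFn root ++ w), h1, h2, List.take_append_drop]
  have hle : ∏ v, (arrangements (N v)).card ≤
      (weakWords F P ξ n).ncard * Fintype.card α ^ (2 * Fintype.card α ^ (m + 1) + m) :=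
    hprod.trans (hWcard.trans (Nat.mul_le_mul_left _
      (Nat.pow_le_pow_right Fintype.card_pos (by omega))))
  have hpos : 0 < ∏ v, (arrangements (N v)).card := by
    refine Finset.prod_pos fun v _ => Nat.pos_of_ne_zero fun h0 => ?_
    have h := factorial_le_card_arrangements_mul (N v)
    have h1 := (∑ a, N v a).factorial_pos
    rw [h0, zero_mul] at h
    omega
  refine ⟨Nat.pos_of_mul_pos_right (hpos.trans_le hle), ?_⟩
  refine (entropy_le_log_prod_card_arrangements N (K := ((n + 1 : ℕ) : ℝ))
    (by exact_mod_cast Nat.le_add_left 1 n) fun v a => ?_).trans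
      (Real.log_le_log (by exact_mod_cast hpos) (by exact_mod_cast hle))
  have h := (hbound v a).1
  have h' := mul_le_mul_of_nonneg_left (hν1 (Fin.snoc (α := fun _ => α) v a))
    (Nat.cast_nonneg (α := ℝ) n)
  push_cast
  linarith

end Lower

/-! ### The capacity -/

section Capacity

/-- The empty word is a proper subword of any nonempty word, so a reduced set that contains a
nonempty word does not contain it. -/
theorem IsReduced.length_bounds {α : Type*} {m : ℕ} {F : Finset (List α)} (hF : IsReduced F)
    (hm : F.sup List.length = m + 1) :
    Nonempty α ∧ ∀ φ ∈ F, 1 ≤ φ.length ∧ φ.length ≤ m + 1 := by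
  have hne : F.Nonempty := by
    by_contra h
    rw [Finset.not_nonempty_iff_eq_empty] at h
    simp [h] at hm
  obtain ⟨ω, hω, hlen⟩ := Finset.exists_mem_eq_sup F hne List.length
  rw [hm] at hlen
  refine ⟨?_, fun φ hφ => ⟨?_, hm ▸ Finset.le_sup (f := List.length) hφ⟩⟩
  · cases ω with
    | nil => simp at hlen
    | cons a _ => exact ⟨a⟩
  · rw [Nat.one_le_iff_ne_zero]
    intro h
    rw [List.length_eq_zero_iff] at h
    exact hF ω hω [] (List.nil_infix) (by simp [← hlen]) (h ▸ hφ)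

variable {α : Type*} [Fintype α] [DecidableEq α] {m : ℕ}

theorem tendsto_log_succ_div :
    Tendsto (fun n : ℕ => Real.log ((n + 1 : ℕ) : ℝ) / n) atTop (𝓝 0) := by
  have h := (Real.tendsto_pow_log_div_mul_add_atTop 1 (-1) 1 one_ne_zero).comp
    (tendsto_natCast_atTop_atTop.comp (tendsto_add_atTop_nat 1))
  refine h.congr fun n => ?_
  simp

/-- A quantity of logarithmic growth is eventually at most `ε n`. -/
theorem eventually_log_le_mul (a b : ℝ) {ε : ℝ} (hε : 0 < ε) :
    ∀ᶠ n : ℕ in atTop, a + b * Real.log ((n + 1 : ℕ) : ℝ) ≤ ε * n := by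
  have h1 : Tendsto (fun n : ℕ => a / n + b * (Real.log ((n + 1 : ℕ) : ℝ) / n)) atTop
      (𝓝 (0 + b * 0)) :=
    (tendsto_const_div_atTop_nhds_zero_nat a).add (tendsto_log_succ_div.const_mul b)
  rw [mul_zero, add_zero] at h1
  filter_upwards [h1.eventually_le_const hε, eventually_gt_atTop 0] with n hn hn0
  have hn0' : (0 : ℝ) < n := by exact_mod_cast hn0
  have h2 : (a / n + b * (Real.log ((n + 1 : ℕ) : ℝ) / n)) * n =
      a + b * Real.log ((n + 1 : ℕ) : ℝ) := by
    field_simp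
  rw [← h2]
  exact mul_le_mul_of_nonneg_right hn hn0'.le

theorem eventually_tolerance_le {ξ : ℕ → ℝ} (hξ : IsTolerance ξ) {δ : ℝ} (hδ : 0 < δ) :
    ∀ᶠ n : ℕ in atTop, ξ n + m / n ≤ δ := by
  have h := ((Asymptotics.isLittleO_one_iff ℝ).1 hξ.isLittleO).add
    (tendsto_const_div_atTop_nhds_zero_nat (m : ℝ))
  rw [add_zero] at h
  exact h.eventually_le_const hδ

variable {F : Finset (List α)} {P : F → ℝ} {ξ : ℕ → ℝ}

theorem eventually_growthRate_eq_bot (hP : P ∈ cube F) (hξ : IsTolerance ξ)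
    (hF : ∀ φ ∈ F, 1 ≤ φ.length ∧ φ.length ≤ m + 1) (hemp : ¬ (feasible F m P).Nonempty) :
    ∀ᶠ n in atTop, growthRate F P ξ n = ⊥ := by
  rw [Set.not_nonempty_iff_eq_empty] at hemp
  obtain ⟨δ, hδ, h⟩ := exists_pos_of_feasible_subset isOpen_empty hemp.subset
  filter_upwards [eventually_tolerance_le (m := m) hξ hδ, eventually_ge_atTop (m + 1)] with n hn hnm
  rw [growthRate, if_pos]
  rw [Set.ncard_eq_zero (weakWords_finite F P ξ n), ← Set.not_nonempty_iff_eq_empty]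
  intro hne
  obtain ⟨τ, hτ, hτP, -⟩ := exists_measure_of_weakWords_nonempty (fun φ => (hP φ).1) hξ.nonneg hF n
    hnm hne
  exact h τ hτ fun φ => (hτP φ).trans (by linarith)

theorem eventually_growthRate_le [Nonempty α] (hP : P ∈ cube F) (hξ : IsTolerance ξ)
    (hF : ∀ φ ∈ F, 1 ≤ φ.length ∧ φ.length ≤ m + 1) {B ε : ℝ} (hε : 0 < ε)
    (hB : ∀ μ ∈ feasible F m P, tupleEntropy μ < B) :
    ∀ᶠ n in atTop, growthRate F P ξ n ≤ (((B + ε) / Real.log 2 : ℝ) : EReal) := by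
  obtain ⟨δ, hδ, h⟩ := exists_pos_of_feasible_subset
    (isOpen_lt continuous_tupleEntropy continuous_const) hB
  filter_upwards [eventually_tolerance_le (m := m) hξ hδ, eventually_ge_atTop (m + 1),
    eventually_log_le_mul (Real.log ((Fintype.card α : ℝ) ^ m))
      ((Fintype.card α ^ (m + 1) : ℕ) : ℝ) hε] with n hn hnm hlog
  rw [growthRate]
  split_ifs with h0
  · exact bot_le
  have hn0 : (0 : ℝ) < n := by exact_mod_cast (by omega : 0 < n)
  obtain ⟨τ, hτ, hτP, hle⟩ := exists_measure_of_weakWords_nonempty (fun φ => (hP φ).1) hξ.nonneg hF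
    n hnm (Set.nonempty_of_ncard_ne_zero h0)
  have hτB : tupleEntropy τ < B := h τ hτ fun φ => (hτP φ).trans (by linarith)
  have hcard : (0 : ℝ) < (weakWords F P ξ n).ncard := by exact_mod_cast Nat.pos_of_ne_zero h0
  have hα : (0 : ℝ) < Fintype.card α := by exact_mod_cast Fintype.card_pos
  have h1 := Real.log_le_log hcard hle
  have h2 : Real.log ((Fintype.card α ^ m * (n + 1) ^ (Fintype.card α ^ (m + 1)) : ℕ) : ℝ) =
      Real.log ((Fintype.card α : ℝ) ^ m) +
        ((Fintype.card α ^ (m + 1) : ℕ) : ℝ) * Real.log ((n + 1 : ℕ) : ℝ) := by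
    rw [Nat.cast_mul, Nat.cast_pow, Nat.cast_pow, Real.log_mul (by positivity) (by positivity),
      Real.log_pow ((n + 1 : ℕ) : ℝ)]
  rw [Real.log_mul (Real.exp_pos _).ne' (by positivity), Real.log_exp, h2] at h1
  have hlog2 : 0 < Real.log 2 := Real.log_pos one_lt_two
  rw [EReal.coe_le_coe_iff, Real.logb, one_div, inv_mul_le_iff₀ hn0, ← mul_div_assoc,
    div_le_div_iff_of_pos_right hlog2]
  nlinarith

theorem eventually_le_growthRate [Nonempty α] (hP : P ∈ cube F)
    (hF : ∀ φ ∈ F, 1 ≤ φ.length ∧ φ.length ≤ m + 1)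
    (hξ_ge : ∀ n : ℕ, 1 ≤ n → 2 * (Fintype.card α : ℝ) ^ m / (n : ℝ) ≤ ξ n)
    {ν : (Fin (m + 1) → α) → ℝ} (hν : ν ∈ feasible F m P) {B ε : ℝ} (hε : 0 < ε)
    (hB : B < tupleEntropy ν) :
    ∀ᶠ n in atTop, (((B - ε) / Real.log 2 : ℝ) : EReal) ≤ growthRate F P ξ n := by
  obtain ⟨δ, hδ, hball⟩ := Metric.isOpen_iff.1
    (isOpen_lt continuous_const (continuous_tupleEntropy (α := α) (m := m))) ν hB
  set c : ℕ := 2 * Fintype.card α ^ (m + 1) + m with hc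
  filter_upwards [(tendsto_const_div_atTop_nhds_zero_nat (1 : ℝ)).eventually_lt_const hδ,
    eventually_ge_atTop (m + 1), eventually_ge_atTop (2 * Fintype.card α ^ m),
    eventually_log_le_mul ((Fintype.card α : ℝ) ^ (m + 1) + c * Real.log (Fintype.card α))
      ((Fintype.card α : ℝ) ^ (m + 1)) hε] with n hn hnm hnc hlog
  have hn0 : (0 : ℝ) < n := by exact_mod_cast (by omega : 0 < n)
  obtain ⟨N, hN, hpos, hle⟩ := exists_weight_le_ncard_weakWords (fun φ => (hP φ).2) hF n
    (hξ_ge n (by omega)) hnm hnc hν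
  have hcard : (0 : ℝ) < (weakWords F P ξ n).ncard := by exact_mod_cast hpos
  have hα : (0 : ℝ) < Fintype.card α := by exact_mod_cast Fintype.card_pos
  have hnear : (fun σ => (n : ℝ)⁻¹ * tupleWeight N σ) ∈ Metric.ball ν δ := by
    rw [Metric.mem_ball, dist_pi_lt_iff hδ]
    intro σ
    refine lt_of_le_of_lt ?_ hn
    have h1 : (n : ℝ)⁻¹ * tupleWeight N σ - ν σ = (n : ℝ)⁻¹ * (tupleWeight N σ - n * ν σ) := by
      field_simp
    rw [Real.dist_eq, h1, abs_mul, abs_of_pos (inv_pos.2 hn0), one_div]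
    exact mul_le_of_le_one_right (inv_pos.2 hn0).le (hN σ)
  have hB' : B < (n : ℝ)⁻¹ * tupleEntropy (tupleWeight N) := by
    rw [← tupleEntropy_smul _ (inv_ne_zero hn0.ne') (tupleWeight_nonneg N)]
    exact hball hnear
  rw [lt_inv_mul_iff₀ hn0] at hB'
  rw [Nat.cast_mul, Nat.cast_pow, Real.log_mul hcard.ne' (by positivity), Real.log_pow] at hle
  have hlog2 : 0 < Real.log 2 := Real.log_pos one_lt_two
  rw [growthRate, if_neg hpos.ne', EReal.coe_le_coe_iff, Real.logb, one_div, le_inv_mul_iff₀ hn0,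
    ← mul_div_assoc, div_le_div_iff_of_pos_right hlog2]
  nlinarith

/-- The growth rate converges to the maximal entropy (in bits) of a feasible measure. -/
theorem tendsto_growthRate [Nonempty α] (hP : P ∈ cube F) (hξ : IsTolerance ξ)
    (hF : ∀ φ ∈ F, 1 ≤ φ.length ∧ φ.length ≤ m + 1)
    (hξ_ge : ∀ n : ℕ, 1 ≤ n → 2 * (Fintype.card α : ℝ) ^ m / (n : ℝ) ≤ ξ n)
    {ν : (Fin (m + 1) → α) → ℝ} (hν : ν ∈ feasible F m P)
    (hmax : IsMaxOn tupleEntropy (feasible F m P) ν) :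
    Tendsto (growthRate F P ξ) atTop (𝓝 ((tupleEntropy ν / Real.log 2 : ℝ) : EReal)) := by
  have hlog2 : 0 < Real.log 2 := Real.log_pos one_lt_two
  refine tendsto_order.2 ⟨fun a ha => ?_, fun a ha => ?_⟩
  · obtain ⟨b, hab, hb⟩ := EReal.lt_iff_exists_real_btwn.1 ha
    rw [EReal.coe_lt_coe_iff, lt_div_iff₀ hlog2] at hb
    set ε := (tupleEntropy ν - b * Real.log 2) / 2 with hε
    filter_upwards [eventually_le_growthRate (B := b * Real.log 2 + ε) (ε := ε) hP hF hξ_ge hν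
      (by linarith) (by linarith)] with n hn
    rw [add_sub_cancel_right, mul_div_cancel_right₀ _ hlog2.ne'] at hn
    exact hab.trans_le hn
  · obtain ⟨b, hb, hab⟩ := EReal.lt_iff_exists_real_btwn.1 ha
    rw [EReal.coe_lt_coe_iff, div_lt_iff₀ hlog2] at hb
    set ε := (b * Real.log 2 - tupleEntropy ν) / 2 with hε
    filter_upwards [eventually_growthRate_le (B := b * Real.log 2 - ε) (ε := ε) hP hξ hF
      (by linarith) fun μ hμ => lt_of_le_of_lt (hmax hμ) (by linarith)] with n hn
    rw [sub_add_cancel, mul_div_cancel_right₀ _ hlog2.ne'] at hn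
    exact hn.trans_lt hab

theorem weakCapacity_eq [Nonempty α] (hP : P ∈ cube F) (hξ : IsTolerance ξ)
    (hF : ∀ φ ∈ F, 1 ≤ φ.length ∧ φ.length ≤ m + 1)
    (hξ_ge : ∀ n : ℕ, 1 ≤ n → 2 * (Fintype.card α : ℝ) ^ m / (n : ℝ) ≤ ξ n)
    (hne : (feasible F m P).Nonempty) :
    ∃ ν ∈ feasible F m P, IsMaxOn tupleEntropy (feasible F m P) ν ∧
      weakCapacity F P ξ = ((tupleEntropy ν / Real.log 2 : ℝ) : EReal) := by
  obtain ⟨ν, hν, hmax⟩ :=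
    (isCompact_feasible P).exists_isMaxOn hne continuous_tupleEntropy.continuousOn
  exact ⟨ν, hν, hmax, (tendsto_growthRate hP hξ hF hξ_ge hν hmax).limsup_eq⟩

theorem iInf_rateFunction_eq [Nonempty α] {ν : (Fin (m + 1) → α) → ℝ} (hν : ν ∈ feasible F m P)
    (hmax : IsMaxOn tupleEntropy (feasible F m P) ν) :
    ⨅ μ ∈ feasible F m P, rateFunction (fun _ : α => 1 / (Fintype.card α : ℝ)) μ =
      ((Real.logb 2 (Fintype.card α) - tupleEntropy ν / Real.log 2 : ℝ) : EReal) := by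
  refine le_antisymm ((iInf₂_le ν hν).trans_eq (rateFunction_eq hν.1)) (le_iInf₂ fun μ hμ => ?_)
  rw [rateFunction_eq hμ.1, EReal.coe_le_coe_iff]
  exact sub_le_sub_left (div_le_div_of_nonneg_right (hmax hμ) (Real.log_pos one_lt_two).le) _

theorem continuousOn_weakCapacity [Nonempty α] (hξ : IsTolerance ξ)
    (hF : ∀ φ ∈ F, 1 ≤ φ.length ∧ φ.length ≤ m + 1)
    (hξ_ge : ∀ n : ℕ, 1 ≤ n → 2 * (Fintype.card α : ℝ) ^ m / (n : ℝ) ≤ ξ n) :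
    ContinuousOn (fun P : F → ℝ => weakCapacity F P ξ)
      {P | P ∈ cube F ∧ (feasible F m P).Nonempty} := by
  have hlog2 : 0 < Real.log 2 := Real.log_pos one_lt_two
  intro P ⟨hP, hne⟩
  obtain ⟨ν, hν, hmax, hcap⟩ := weakCapacity_eq hP hξ hF hξ_ge hne
  rw [ContinuousWithinAt, hcap]
  refine tendsto_order.2 ⟨fun a ha => ?_, fun a ha => ?_⟩
  · obtain ⟨b, hab, hb⟩ := EReal.lt_iff_exists_real_btwn.1 ha
    rw [EReal.coe_lt_coe_iff, lt_div_iff₀ hlog2] at hb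
    obtain ⟨δ, hδ, hball⟩ := Metric.isOpen_iff.1
      (isOpen_lt continuous_const (continuous_tupleEntropy (α := α) (m := m))) ν hb
    filter_upwards [nhdsWithin_le_nhds (exists_feasible_near hν hδ), self_mem_nhdsWithin]
      with Q hQ ⟨hQc, hQne⟩
    obtain ⟨μ, hμ, hdist⟩ := hQ hQne
    obtain ⟨ν', hν', hmax', hcap'⟩ := weakCapacity_eq hQc hξ hF hξ_ge hQne
    rw [hcap']
    refine hab.trans_le ?_
    rw [EReal.coe_le_coe_iff, le_div_iff₀ hlog2]
    have h1 : b * Real.log 2 < tupleEntropy μ := hball (by rwa [Metric.mem_ball, dist_eq_norm])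
    exact h1.le.trans (hmax' hμ)
  · obtain ⟨b, hb, hab⟩ := EReal.lt_iff_exists_real_btwn.1 ha
    rw [EReal.coe_lt_coe_iff, div_lt_iff₀ hlog2] at hb
    obtain ⟨δ, hδ, h⟩ := exists_pos_of_feasible_subset (P := P)
      (isOpen_lt (continuous_tupleEntropy (α := α) (m := m)) continuous_const)
      (fun μ hμ => lt_of_le_of_lt (hmax hμ) hb)
    filter_upwards [nhdsWithin_le_nhds (Metric.ball_mem_nhds P hδ), self_mem_nhdsWithin]
      with Q hQ ⟨hQc, hQne⟩
    obtain ⟨ν', hν', hmax', hcap'⟩ := weakCapacity_eq hQc hξ hF hξ_ge hQne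
    rw [hcap']
    refine lt_of_lt_of_le ?_ hab.le
    rw [EReal.coe_lt_coe_iff, div_lt_iff₀ hlog2]
    refine h ν' hν'.1 fun φ => (hν'.2.2 φ).trans ?_
    rw [Metric.mem_ball, dist_pi_lt_iff hδ] at hQ
    have h1 := (abs_lt.1 (Real.dist_eq _ _ ▸ hQ φ)).2
    linarith

end Capacity

end Semiconstrained

end

theorem mainTheorem1 {α : Type*} [Fintype α] [DecidableEq α]
    (F : Finset (List α)) (hF : Semiconstrained.IsReduced F)
    (m : ℕ) (hm : F.sup List.length = m + 1)
    (ξ : ℕ → ℝ) (hξ : Semiconstrained.IsTolerance ξ)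
    (hξ_ge : ∀ n : ℕ, 1 ≤ n → 2 * (Fintype.card α : ℝ) ^ m / (n : ℝ) ≤ ξ n) :
    (∀ P ∈ Semiconstrained.cube F,
      Tendsto (Semiconstrained.growthRate F P ξ) atTop
        (𝓝 (Semiconstrained.weakCapacity F P ξ)) ∧
      ((Semiconstrained.feasible F m P).Nonempty →
        Semiconstrained.weakCapacity F P ξ =
          ((Real.logb 2 (Fintype.card α : ℝ) : ℝ) : EReal) -
            ⨅ μ ∈ Semiconstrained.feasible F m P,
              Semiconstrained.rateFunction (fun _ : α => 1 / (Fintype.card α : ℝ)) μ)) ∧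
    ContinuousOn (fun P : F → ℝ => Semiconstrained.weakCapacity F P ξ)
      {P | P ∈ Semiconstrained.cube F ∧ (Semiconstrained.feasible F m P).Nonempty} := by
  obtain ⟨hα, hlen⟩ := hF.length_bounds hm
  refine ⟨fun P hP => ⟨?_, fun hne => ?_⟩, Semiconstrained.continuousOn_weakCapacity hξ hlen hξ_ge⟩
  · by_cases hne : (Semiconstrained.feasible F m P).Nonempty
    · obtain ⟨ν, hν, hmax, hcap⟩ := Semiconstrained.weakCapacity_eq hP hξ hlen hξ_ge hne
      rw [hcap]
      exact Semiconstrained.tendsto_growthRate hP hξ hlen hξ_ge hν hmax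
    · have h : Tendsto (Semiconstrained.growthRate F P ξ) atTop (𝓝 ⊥) :=
        tendsto_const_nhds.congr'
          ((Semiconstrained.eventually_growthRate_eq_bot hP hξ hlen hne).mono fun _ hn => hn.symm)
      rwa [Semiconstrained.weakCapacity, h.limsup_eq]
  · obtain ⟨ν, hν, hmax, hcap⟩ := Semiconstrained.weakCapacity_eq hP hξ hlen hξ_ge hne
    rw [hcap, Semiconstrained.iInf_rateFunction_eq hν hmax, ← EReal.coe_sub, sub_sub_cancel]
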